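/- **Setting.** A ballot path of length $N$ is a lattice path from $(0,0)$ with $N$ steps $U=(1,1)$ or $D=(1,-1)$ that never goes below $y=0$; it has length $(2n,n')$ if it ends at $(2n+n',n')$. A box with centre $(x,y)$ is the square with corners $(x\pm1,y),(x,y\pm1)$, these corners being lattice points with even coordinate sum. If $\lambda,\mu$ are ballot paths of length $N$ and $\lambda$ is weakly below $\mu$, the shifted skew shape $\lambda/\mu$ consists of the boxes centred strictly between $\lambda$ and $\mu$ on the lines $x=1,\dots,N$; those centred on $x=N$ are the anchor boxes. A ballot tile of length $(2n,n')$ is a set of boxes whose centres form a translate of a ballot path of length $(2n,n')$ (for $n'=0$: a Dyck tile). Let $\mathcal B^{I}(\lambda/\mu)$ be the set of tilings of $\lambda/\mu$ by ballot tiles such that * (cover-inclusive) each tile, moved down by one box (that is, by $(0,-2)$), is strictly below $\lambda$ or contained in another tile; * the rightmost box of each tile of length $(2n,n')$ with $n'\ge 1$ is an anchor box; * for all $n,n'$, the number of tiles of length $(2n,n')$ is even if $n'$ is odd, and zero if $n'>0$ is even. Let $\mathrm{tiles}(B)$ be the number of Dyck tiles of $B$ (tiles with $n'\ge1$ count $0$),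 let $\mathcal B^{I}(\ast/\mu)=\bigcup_\lambda \mathcal B^{I}(\lambda/\mu)$ over all ballot paths $\lambda$ of length $N$ weakly below $\mu$, and $$P^{I}_{\ast,\mu}=\sum_{B\in\mathcal B^{I}(\ast/\mu)}q^{\mathrm{tiles}(B)}.$$ A generalized perfect matching of type I on $\mu$ is a partition of the positions $1,\dots,N$ of $\mu$ into arcs, each joining a $U$ to a $D$ on its right, dashed arcs, each joining two $U$'s, and at most one diamond, placed on a $U$. Let $\mathrm{PM}_I(\mu)$ be the set of these. Write $(i,j)$, $i<j$, for an arc or dashed arc with endpoints $i,j$; $(k,l)$ is nested in $(i,j)$ if $i<k<l<j$, and $(i,j)$ crosses the later $(k,l)$ if $i<k<j<l$. For $\pi\in\mathrm{PM}_I(\mu)$ let $c(\pi)$ be the sum of * $2$ for each dashed arc nested in a dashed arc, and $2$ for each dashed arc nested in an arc (over all such pairs); * $1$ for each pair of crossing dashed arcs; * $1$ for each dashed arc crossing a later arc; * $1$ for each dashed arc $(i,j)$ with the diamond at a position $d$, $i<d<j$; $2$ for each dashed arc with the diamond to its left ($d<i$); $1$ for each arc with the diamond to its left ($d<i$). Let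 $\mathrm{nes}(\pi)$ be $c(\pi)$ plus the number of pairs of an arc nested in an arc or in a dashed arc. Let $\mathrm{cr}(\pi)$ be $c(\pi)$ plus the number of pairs of an arc crossing a later arc or a later dashed arc. **Theorem.** Let $N$ be odd and let $\mu$ be a ballot path of length $N$. Then $$P^{I}_{\ast,\mu}=\sum_{\pi\in \mathrm{PM}_I(\mu)}q^{\mathrm{nes}(\pi)}=\sum_{\pi\in \mathrm{PM}_I(\mu)}q^{\mathrm{cr}(\pi)}.$$ -/

import Mathlib

namespace BallotTiling

open Polynomial

/-- A step of a lattice path: `U = (1, 1)` or `D = (1, -1)`. -/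
inductive Step
  | U
  | D
  deriving DecidableEq

instance : Fintype Step := ⟨{.U, .D}, fun s => by cases s <;> simp⟩

/-- The vertical displacement of a step. -/
def Step.rise : Step → ℤ
  | .U => 1
  | .D => -1

/-- A path of length `N`, starting at the origin. Positions are numbered `0, …, N - 1` from left
to right; step number `i` leads from the line `x = i` to the line `x = i + 1`. -/
abbrev Path (N : ℕ) := Fin N → Step

/-- The height of the path `w` on the line `x = k`. -/
def height {N : ℕ} (w : Path N) (k : ℕ) : ℤ :=
  ∑ i : Fin N with i.val < k, (w i).rise

/-- A ballot path is a path that does not go below the line `y = 0`. -/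
def IsBallot {N : ℕ} (w : Path N) : Prop :=
  ∀ k ≤ N, 0 ≤ height w k

/-- `w` is a ballot path of length `(2n, n')`: it ends at `(2n + n', n')`. -/
def IsBallotOfLength (n n' : ℕ) (w : Path (2 * n + n')) : Prop :=
  IsBallot w ∧ height w (2 * n + n') = n'

/-- The path `l` lies weakly below the path `u`, that is, the skew shape `l / u` exists. -/
def IsBelow {N : ℕ} (l u : Path N) : Prop :=
  ∀ k ≤ N, height l k ≤ height u k

/-- A box, given by its centre `(x, y)`. The box has the corners `(x ± 1, y)` and `(x, y ± 1)`. -/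
abbrev Box := ℕ × ℤ

/-- The boxes of the shifted skew shape with lower path `l` and upper path `u`: the lattice boxes
centred strictly between the two paths on one of the lines `x = 1, …, x = N`. The boxes centred
on the line `x = N` are the anchor boxes. (The corners of a lattice box are points that paths from
the origin can visit, so that the coordinates of its centre have an odd sum. The heights of the
paths lie in `[-N, N]`.) -/
noncomputable def skewShape {N : ℕ} (l u : Path N) : Finset Box :=
  {b ∈ Finset.Icc 1 N ×ˢ Finset.Icc (-(N : ℤ)) N |
    Odd ((b.1 : ℤ) + b.2) ∧ height l b.1 < b.2 ∧ b.2 < height u b.1}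

/-- `T` is a ballot tile of length `(2n, n')`: the centres of its boxes, from left to right, form
a translate of a ballot path of length `(2n, n')`. For `n' = 0` this is a Dyck tile. -/
def IsBallotTile (n n' : ℕ) (T : Finset Box) : Prop :=
  ∃ (x : ℕ) (y : ℤ) (w : Path (2 * n + n')), IsBallotOfLength n n' w ∧
    T = (Finset.range (2 * n + n' + 1)).image fun i => (x + i, y + height w i)

/-- The box just below a box, in the same column. -/
def down (b : Box) : Box := (b.1, b.2 - 2)

open Classical in
/-- `𝒯` is a cover-inclusive ballot tiling of type BI of the shifted skew shape `l / u`. -/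
structure IsTilingBI {N : ℕ} (l u : Path N) (𝒯 : Finset (Finset Box)) : Prop where
  /-- Every piece is a ballot tile. -/
  tile : ∀ T ∈ 𝒯, ∃ n n', IsBallotTile n n' T
  /-- Two tiles do not overlap. -/
  disjoint : ∀ T ∈ 𝒯, ∀ T' ∈ 𝒯, T ≠ T' → Disjoint T T'
  /-- The tiles cover the shape and nothing else. -/
  cover : 𝒯.biUnion id = skewShape l u
  /-- Cover-inclusive: a tile translated downward by one box is strictly below the lower path or
  contained in another tile. -/
  coverInclusive : ∀ T ∈ 𝒯,
    (∀ b ∈ T, (down b).2 < height l (down b).1) ∨ ∃ T' ∈ 𝒯, T.image down ⊆ T'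
  /-- The rightmost box of a tile of length `(2n, n')` with `n' ≥ 1` is an anchor box. -/
  anchor : ∀ T ∈ 𝒯, ∀ n n', 1 ≤ n' → IsBallotTile n n' T → ∃ y, (N, y) ∈ T
  /-- For odd `n'` the number of tiles of length `(2n, n')` is even. -/
  even_of_odd : ∀ n n', Odd n' → Even ({T ∈ 𝒯 | IsBallotTile n n' T}).card
  /-- For even `n' > 0` there is no tile of length `(2n, n')`. -/
  zero_of_even : ∀ n n', Even n' → 0 < n' → ({T ∈ 𝒯 | IsBallotTile n n' T}).card = 0

open Classical in
/-- The set of cover-inclusive ballot tilings of type BI of the shape `l / u`. -/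
noncomputable def tilingsBI {N : ℕ} (l u : Path N) : Finset (Finset (Finset Box)) :=
  {𝒯 ∈ (skewShape l u).powerset.powerset | IsTilingBI l u 𝒯}

open Classical in
/-- The set of cover-inclusive ballot tilings of type BI with upper path `u`: the union, over all
ballot paths `l` weakly below `u`, of the sets of tilings of the shapes `l / u`. -/
noncomputable def tilingsUpperBI {N : ℕ} (u : Path N) : Finset (Finset (Finset Box)) :=
  ({l : Path N | IsBallot l ∧ IsBelow l u} : Finset (Path N)).biUnion fun l => tilingsBI l u

open Classical in
/-- The statistic `tiles`: a Dyck tile counts `1`, a tile of length `(2n, n')`, `n' ≥ 1`,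
counts `0`. -/
noncomputable def tiles (𝒯 : Finset (Finset Box)) : ℕ :=
  ({T ∈ 𝒯 | ∃ n, IsBallotTile n 0 T}).card

/-- The generating function `P^I_{∗,u}`, a polynomial in the variable `q = X`. -/
noncomputable def upperGF {N : ℕ} (u : Path N) : ℤ[X] :=
  ∑ 𝒯 ∈ tilingsUpperBI u, X ^ tiles 𝒯

/-- Diagrams on the positions of a path: a set of arcs, a set of dashed arcs (each recorded as
the pair of its endpoints) and a set of diamonds. -/
abbrev Diagram (N : ℕ) :=
  Finset (Fin N × Fin N) × Finset (Fin N × Fin N) × Finset (Fin N)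

namespace Diagram

variable {N : ℕ}

/-- The arcs of a diagram. -/
def arcs (π : Diagram N) : Finset (Fin N × Fin N) := π.1

/-- The dashed arcs of a diagram. -/
def dashed (π : Diagram N) : Finset (Fin N × Fin N) := π.2.1

/-- The positions of the diamonds of a diagram. -/
def diamonds (π : Diagram N) : Finset (Fin N) := π.2.2

/-- `π` is a generalized perfect matching of type I on the path `u`. -/
structure IsMatchingI (u : Path N) (π : Diagram N) : Prop where
  /-- An arc connects a `U` to a `D` on its right. -/
  arc : ∀ a ∈ π.arcs, a.1 < a.2 ∧ u a.1 = .U ∧ u a.2 = .D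
  /-- A dashed arc connects two `U`'s. -/
  dash : ∀ a ∈ π.dashed, a.1 < a.2 ∧ u a.1 = .U ∧ u a.2 = .U
  /-- A diamond is on a `U`. -/
  diamond : ∀ i ∈ π.diamonds, u i = .U
  /-- There is at most one diamond. -/
  diamond_le_one : π.diamonds.card ≤ 1
  /-- Every position is on exactly one arc, dashed arc or diamond. -/
  perfect : ∀ i : Fin N,
    ({a ∈ π.arcs | a.1 = i ∨ a.2 = i}).card + ({a ∈ π.dashed | a.1 = i ∨ a.2 = i}).card
      + ({j ∈ π.diamonds | j = i}).card = 1

/-- The arc `b` is nested inside the arc `a`. -/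
def Nested (a b : Fin N × Fin N) : Prop := a.1 < b.1 ∧ b.1 < b.2 ∧ b.2 < a.2

/-- The arcs `a` and `b` cross and `a` starts to the left of `b`. -/
def Crossing (a b : Fin N × Fin N) : Prop := a.1 < b.1 ∧ b.1 < a.2 ∧ a.2 < b.2

instance (a b : Fin N × Fin N) : Decidable (Nested a b) := by unfold Nested; infer_instance

instance (a b : Fin N × Fin N) : Decidable (Crossing a b) := by unfold Crossing; infer_instance

/-- The partial sequence of integers with a `1` at position `i` and `0` elsewhere. -/
def one (i : Fin N) : Fin N → ℕ := Pi.single i 1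

/-- The sum of the partial sequences that the statistics `nes` and `cr` have in common. -/
def commonSeq (π : Diagram N) : Fin N → ℕ :=
  -- a dashed arc `b` nested in a dashed arc `a`
  (∑ a ∈ π.dashed, ∑ b ∈ π.dashed, if Nested a b then one b.1 + one b.2 else 0)
  -- two crossing dashed arcs `a`, `b`
  + (∑ a ∈ π.dashed, ∑ b ∈ π.dashed, if Crossing a b then one a.2 else 0)
  -- a dashed arc `a` that crosses an arc `b` which starts later
  + (∑ a ∈ π.dashed, ∑ b ∈ π.arcs, if Crossing a b then one a.2 else 0)
  -- a diamond `d` under a dashed arc `a`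
  + (∑ a ∈ π.dashed, ∑ d ∈ π.diamonds, if a.1 < d ∧ d < a.2 then one a.2 else 0)
  -- a diamond `d` to the left of a dashed arc `a`
  + (∑ a ∈ π.dashed, ∑ d ∈ π.diamonds, if d < a.1 then one a.1 + one a.2 else 0)
  -- a dashed arc `b` nested in an arc `a`
  + (∑ a ∈ π.arcs, ∑ b ∈ π.dashed, if Nested a b then one b.1 + one b.2 else 0)
  -- a diamond `d` to the left of an arc `a`
  + (∑ a ∈ π.arcs, ∑ d ∈ π.diamonds, if d < a.1 then one a.1 else 0)

/-- The sequence `p_nes`. -/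
def nesSeq (π : Diagram N) : Fin N → ℕ :=
  π.commonSeq
  -- an arc `b` nested in a dashed arc `a`
  + (∑ a ∈ π.dashed, ∑ b ∈ π.arcs, if Nested a b then one b.1 else 0)
  -- an arc `b` nested in an arc `a`
  + (∑ a ∈ π.arcs, ∑ b ∈ π.arcs, if Nested a b then one b.1 else 0)

/-- The sequence `p_cr`. -/
def crSeq (π : Diagram N) : Fin N → ℕ :=
  π.commonSeq
  -- an arc `a` that crosses a dashed arc `b` which starts later
  + (∑ a ∈ π.arcs, ∑ b ∈ π.dashed, if Crossing a b then one b.1 else 0)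
  -- two crossing arcs `a`, `b`
  + (∑ a ∈ π.arcs, ∑ b ∈ π.arcs, if Crossing a b then one b.1 else 0)

/-- The statistic `nes`. -/
def nes (π : Diagram N) : ℕ := ∑ i, π.nesSeq i

/-- The statistic `cr`. -/
def cr (π : Diagram N) : ℕ := ∑ i, π.crSeq i

end Diagram

open Classical in
/-- The set `PM_I(u)` of generalized perfect matchings of type I on the path `u`. -/
noncomputable def matchingsI {N : ℕ} (u : Path N) : Finset (Diagram N) :=
  {π : Diagram N | π.IsMatchingI u}

end BallotTiling

namespace BallotTiling

open Polynomial

/-! ### The algebra of the two steps -/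

/-! Both generating functions are computed by a transfer operator along `μ`: each letter acts on
functions of a state, and the sum is the value at the initial state of the product applied to a
final weight. In both models the operators satisfy the `q`-Weyl relation `UD = 1 + q DU`, `D`
vanishes at the initial state, and the final weight obeys `U fin = q D fin + fin0` with `U fin0 = D
fin0 = fin`. These identities (`StepSystem`) determine the weight of every word of odd length: `U^n
D w` reduces to `[n] U^(n-1) w`, `U^(n+2)` reduces to `[n+2] U^n`, and `U` has weight `1`. Hence the
two models agree (`StepSystem.ev_vac_eq`), with no bijection between them.

Matchings. Reading `μ` from the left, it suffices to remember how many `U`'s are still open and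
whether the diamond has been placed. The weights of open positions are chosen so that closing one of
them changes the statistic only through the other open positions and the diamond. An arc may close
any of the `h` open positions; its cost is the number of open positions to the left of the chosen
one for `nes`, to the right for `cr`. Either way the choices sum to `[h]`, so `nes` and `cr` have
the same transfer operators (`Diagram.sum_partials_succ`). Treating the future diamond as one more
open position gives the simpler `openSystem` (`openSystem_ev`).

Tilings. Cover-inclusiveness forces every tile to run parallel to the lower path at a constant level
(`IsTilingBI.level_eq`), and a level continues from one line to the next only if all levels below it
do (`IsTilingBI.linked_pred`). So a tiling amounts to a code: the lower path `l` and, for each line,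
the number `e k` of levels continued to the next line. A tile that stops before the line `x = N`
returns to its starting height and is a Dyck tile. Therefore a state needs only the starting heights
of the current tiles and, for the evenness condition, the places where the starting column changes.
Runs through these states are codes, weighted by `q^tiles` or by `0` if the parity conditions fail
(`upperGF_eq_ev`). -/

/-- The `q`-number `1 + q + ⋯ + q ^ (n - 1)`. -/
noncomputable def qNum (n : ℕ) : ℤ[X] := ∑ i ∈ Finset.range n, X ^ i

@[simp] lemma qNum_zero : qNum 0 = 0 := by simp [qNum]

@[simp] lemma qNum_one : qNum 1 = 1 := by simp [qNum]

lemma qNum_succ (n : ℕ) : qNum (n + 1) = qNum n + X ^ n := Finset.sum_range_succ _ _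

lemma qNum_succ' (n : ℕ) : qNum (n + 1) = X * qNum n + 1 := by
  simp [qNum, Finset.sum_range_succ', Finset.mul_sum, pow_succ']

/-- A representation of the two steps on the functions on a set of states, satisfying the
`q`-Weyl relation, with a vacuum state and two final functions. -/
structure StepSystem (σ : Type*) where
  /-- The action of a step. -/
  op : Step → (σ → ℤ[X]) →ₗ[ℤ[X]] (σ → ℤ[X])
  /-- The initial state. -/
  vac : σ
  /-- The final weight. -/
  fin : σ → ℤ[X]
  /-- The final weight for words of even length. -/
  fin0 : σ → ℤ[X]
  weyl : ∀ f, op .U (op .D f) = f + (X : ℤ[X]) • op .D (op .U f)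
  vac_D : ∀ f, op .D f vac = 0
  fin_U : op .U fin = (X : ℤ[X]) • op .D fin + fin0
  fin0_eq : ∀ s, op s fin0 = fin
  vac_U : op .U fin vac = 1

/-- The weight of a word, as a function of the state in which it is read. -/
noncomputable def evalWord {σ : Type*} (op : Step → (σ → ℤ[X]) →ₗ[ℤ[X]] (σ → ℤ[X]))
    (fin : σ → ℤ[X]) : List Step → σ → ℤ[X]
  | [] => fin
  | s :: w => op s (evalWord op fin w)

namespace StepSystem

variable {σ : Type*} (A : StepSystem σ)

/-- The weight of a word in a step system. -/
noncomputable def ev (w : List Step) : σ → ℤ[X] := evalWord A.op A.fin w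

lemma ev_replicate_append (n : ℕ) (w : List Step) :
    A.ev (List.replicate n .U ++ w) = (A.op .U)^[n] (A.ev w) := by
  induction n with
  | zero => rfl
  | succ n ih =>
    rw [Function.iterate_succ_apply', ← ih]; rfl

/-- Each passage of `D` through a `U` by `weyl` leaves a term in which the two cancel; the powers of
`q` collected in these terms add up to `[n]`. At `n = 0` the truncated exponent is harmless because
its coefficient is `0`. -/
lemma iterate_U_D (n : ℕ) (f : σ → ℤ[X]) :
    (A.op .U)^[n] (A.op .D f)
      = qNum n • (A.op .U)^[n - 1] f + (X ^ n : ℤ[X]) • A.op .D ((A.op .U)^[n] f) := by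
  induction n with
  | zero => simp
  | succ n ih =>
    have h : qNum n • A.op .U ((A.op .U)^[n - 1] f) = qNum n • (A.op .U)^[n] f := by
      rcases n with _ | n
      · simp
      · rw [Nat.add_sub_cancel, Function.iterate_succ_apply']
    rw [Function.iterate_succ_apply', ih, map_add, map_smul, map_smul, h, A.weyl,
      Nat.add_sub_cancel, Function.iterate_succ_apply', qNum_succ, smul_add, smul_smul, ← pow_succ,
      ← add_assoc, ← add_smul]

lemma ev_replicate_D (n : ℕ) (w : List Step) :
    A.ev (List.replicate n .U ++ .D :: w) A.vac
      = qNum n * A.ev (List.replicate (n - 1) .U ++ w) A.vac := by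
  have : A.ev (.D :: w) = A.op .D (A.ev w) := rfl
  rw [ev_replicate_append, ev_replicate_append, this, iterate_U_D]
  simp [A.vac_D]

/-- The last `U` is expanded by `fin_U`. Its `D` part contributes `q [n+1]`, its `fin0` part absorbs
one more `U` and contributes `1`, and `q [n+1] + 1 = [n+2]`. -/
lemma ev_replicate_add_two (n : ℕ) :
    A.ev (List.replicate (n + 2) .U) A.vac = qNum (n + 2) * A.ev (List.replicate n .U) A.vac := by
  have h1 : List.replicate (n + 2) Step.U = List.replicate (n + 1) .U ++ [.U] := by
    rw [List.replicate_succ']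
  have h2 : A.ev [.U] = (X : ℤ[X]) • A.ev [.D] + A.fin0 := A.fin_U
  have h3 : ∀ (n : ℕ) f g, (A.op .U)^[n] ((X : ℤ[X]) • f + g)
      = (X : ℤ[X]) • (A.op .U)^[n] f + (A.op .U)^[n] g := by
    intro n f g
    induction n with
    | zero => rfl
    | succ n ih => simp only [Function.iterate_succ_apply', ih, map_add, map_smul]
  have h4 : (A.op .U)^[n + 1] A.fin0 = A.ev (List.replicate n .U) := by
    rw [Function.iterate_succ_apply, A.fin0_eq]
    exact (A.ev_replicate_append n []).symm.trans (by rw [List.append_nil])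
  have h5 := A.ev_replicate_D (n + 1) []
  simp only [Nat.add_sub_cancel, List.append_nil] at h5
  rw [h1, ev_replicate_append, h2, h3, h4, ← ev_replicate_append, Pi.add_apply, Pi.smul_apply, h5,
    smul_eq_mul, ← mul_assoc, qNum_succ' (n + 1)]
  ring

lemma exists_prefix (w : List Step) :
    w = List.replicate w.length .U ∨ ∃ n w', w = List.replicate n .U ++ .D :: w' := by
  induction w with
  | nil => simp
  | cons s w ih =>
    cases s with
    | D => exact Or.inr ⟨0, w, rfl⟩
    | U =>
      rcases ih with ih | ⟨n, w', ih⟩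
      · left
        rw [List.length_cons, List.replicate_succ, ← ih]
      · exact Or.inr ⟨n + 1, w', by rw [ih]; rfl⟩

/-- The weights of the words of odd length in the vacuum do not depend on the system. -/
theorem ev_vac_eq {τ : Type*} (B : StepSystem τ) :
    ∀ (m : ℕ) (w : List Step), w.length = m → Odd m → A.ev w A.vac = B.ev w B.vac := by
  intro m
  induction m using Nat.strong_induction_on with
  | _ m ih =>
    intro w hw hm
    -- Both reductions shorten the word by two letters, so the length stays odd and the recursion
    -- ends at the word `U` or at a word beginning with `D`, whose weight is `0`.
    rcases exists_prefix w with h | ⟨n, w', h⟩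
    · rw [hw] at h
      rcases m with _ | _ | m
      · simp at hm
      · rw [h]
        exact A.vac_U.trans B.vac_U.symm
      · have := ih m (by omega) (List.replicate m .U) (by simp) (by grind)
        rw [h, ev_replicate_add_two, ev_replicate_add_two, this]
    · rw [h, ev_replicate_D, ev_replicate_D]
      rcases n with _ | n
      · simp
      · rw [h] at hw
        simp only [List.length_append, List.length_replicate, List.length_cons] at hw
        rw [ih (n + w'.length) (by omega) _ (by simp) (by grind)]

end StepSystem

/-! ### Words and diagrams -/

/-- The step system of the diagrams with undistinguished open positions. The state is the number
of open positions. -/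
noncomputable def openSystem : StepSystem ℕ where
  op
    | .U =>
      { toFun := fun f h => f (h + 1) + X ^ (h - 1) * qNum h * f (h - 1)
        map_add' := fun f g => by ext1 h; simp only [Pi.add_apply]; ring
        map_smul' := fun c f => by
          ext1 h; simp only [Pi.smul_apply, smul_eq_mul, RingHom.id_apply]; ring }
    | .D =>
      { toFun := fun f h => qNum h * f (h - 1)
        map_add' := fun f g => by ext1 h; simp only [Pi.add_apply]; ring
        map_smul' := fun c f => by
          ext1 h; simp only [Pi.smul_apply, smul_eq_mul, RingHom.id_apply]; ring }
  vac := 0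
  fin h := if h = 1 then 1 else 0
  fin0 h := if h = 0 then 1 else 0
  -- The terms that lower the state twice cancel; what remains is `[h+1] - q [h] = 1`.
  weyl f := by
    ext1 h
    rcases h with _ | _ | h
    · simp
    · simp [qNum_succ]; ring
    · simp only [LinearMap.coe_mk, AddHom.coe_mk, Pi.add_apply, Pi.smul_apply, smul_eq_mul,
        Nat.add_sub_cancel, qNum_succ' (h + 2), pow_succ, show h + 2 - 1 = h + 1 by omega]
      ring
  vac_D f := by simp
  fin_U := by
    ext1 h
    rcases h with _ | _ | _ | h <;> simp
  fin0_eq s := by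
    ext1 h
    cases s <;> rcases h with _ | _ | h <;> simp
  vac_U := by simp

/-- The action of a step on the functions on the states `(h, e)`, where `h` is the number of open
positions of a diagram and `e` is the number of its diamonds. -/
noncomputable def markedOp : Step → (ℕ × ℕ → ℤ[X]) →ₗ[ℤ[X]] (ℕ × ℕ → ℤ[X])
  | .U =>
    { toFun := fun f p => X ^ p.2 * f (p.1 + 1, p.2)
        + X ^ (p.2 + p.1 - 1) * qNum p.1 * f (p.1 - 1, p.2)
        + if p.2 = 0 then f (p.1, 1) else 0
      map_add' := fun f g => by ext1 h; simp only [Pi.add_apply]; split_ifs <;> ring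
      map_smul' := fun c f => by
        ext1 h; simp only [Pi.smul_apply, smul_eq_mul, RingHom.id_apply]; split_ifs <;> ring }
  | .D =>
    { toFun := fun f p => qNum p.1 * f (p.1 - 1, p.2)
      map_add' := fun f g => by ext1 h; simp only [Pi.add_apply]; ring
      map_smul' := fun c f => by
        ext1 h; simp only [Pi.smul_apply, smul_eq_mul, RingHom.id_apply]; ring }

/-- The final weight on the states of `markedOp`: nothing is open, and there is a diamond. -/
noncomputable def markedFin (p : ℕ × ℕ) : ℤ[X] := if p = (0, 1) then 1 else 0

/-- The map `f ↦ f(h, 0) + [h] f(h - 1, 1)` intertwines `markedOp` with the operators of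
`openSystem` and sends `markedFin` to `fin`: one of the `h` open positions may be singled out as the
diamond. For the terms `f(h, 1)` under `U` this is again `q [h] + 1 = [h+1]`. -/
lemma openSystem_ev (w : List Step) (h : ℕ) :
    openSystem.ev w h = evalWord markedOp markedFin w (h, 0)
      + qNum h * evalWord markedOp markedFin w (h - 1, 1) := by
  induction w generalizing h with
  | nil =>
    rcases h with _ | _ | h <;> simp [StepSystem.ev, evalWord, openSystem, markedFin]
  | cons s w ih =>
    have h1 : openSystem.ev (s :: w) = openSystem.op s (openSystem.ev w) := rfl
    have h2 : openSystem.ev w = fun h => _ := funext ih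
    have h3 : evalWord markedOp markedFin (s :: w)
      = markedOp s (evalWord markedOp markedFin w) := rfl
    rw [h1, h2, h3]
    generalize evalWord markedOp markedFin w = f
    cases s
    · rcases h with _ | _ | h
      · simp [openSystem, markedOp]
      · simp [openSystem, markedOp, qNum_succ]; ring
      · simp only [openSystem, markedOp, LinearMap.coe_mk, AddHom.coe_mk, Nat.add_sub_cancel,
          qNum_succ' (h + 2), show h + 2 - 1 = h + 1 by omega,
          show 1 + (h + 1) - 1 = h + 1 by omega,
          pow_zero, if_true, one_ne_zero, if_false, pow_one, zero_add]
        ring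
    · rcases h with _ | _ | h
      · simp [openSystem, markedOp]
      · simp [openSystem, markedOp]
      · simp [openSystem, markedOp]; ring

/-! ### The step system of the tilings -/

/-- A new group of `n` levels: its lowest level is the only one that starts a group. -/
def freshGroup : ℕ → List Bool
  | 0 => []
  | n + 1 => false :: List.replicate n true

@[simp] lemma length_freshGroup (n : ℕ) : (freshGroup n).length = n := by
  cases n <;> simp [freshGroup]

lemma take_freshGroup (n i : ℕ) (h : i ≤ n) : (freshGroup n).take i = freshGroup i := by
  rcases n with _ | n
  · simp [freshGroup, Nat.le_zero.1 h]
  · rcases i with _ | i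
    · simp [freshGroup]
    · simp only [freshGroup, List.take_succ_cons, List.take_replicate]
      rw [Nat.min_eq_left (by omega)]

/-- A state: the block of the levels whose tiles start at the current height, and the list of the
blocks of the levels whose tiles start at the lower heights, from top to bottom. -/
abbrev State := List Bool × List (List Bool)

/-- The levels in a list of blocks, from bottom to top, with the heights at which their tiles
start. -/
def levels : List (List Bool) → List (ℕ × Bool)
  | [] => []
  | a :: r => levels r ++ a.map fun b => (r.length, b)

/-- The number of levels in a list of blocks. -/
def size (σ : List (List Bool)) : ℕ := (levels σ).length

lemma size_cons (a : List Bool) (r : List (List Bool)) : size (a :: r) = size r + a.length := by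
  simp [size, levels]

/-- The state that arises by an up step of the lower path, if `i` levels of the top block are
continued and `n` levels are new. -/
def upState (a : List Bool) (r : List (List Bool)) (i n : ℕ) : State :=
  (freshGroup n, a.take i :: r)

/-- The state that arises by a down step of the lower path, if `n` levels are new. -/
def downState (b : List Bool) (r : List (List Bool)) (n : ℕ) : State :=
  (b ++ freshGroup n, r)

/-- The contribution to the action of a step that comes from a down step of the lower path. -/
noncomputable def downPart (f : State → ℤ[X]) (n : ℕ) : List (List Bool) → ℤ[X]
  -- With no lower block the lower path is at height `0` and cannot step down.
  | [] => 0
  | b :: r => f (downState b r n)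

/-- The function underlying `tileOp`. -/
noncomputable def tileFun (f : State → ℤ[X]) : Step → State → ℤ[X]
  -- If the lower path goes up, `i` levels of the top block continue and the others end at their
  -- starting height, as Dyck tiles of weight `X` each. If it goes down, every tile of the top block
  -- must end, since it may not sink below its start, and no tile of a lower block may end.
  | .U, (a, r) => ∑ i ∈ Finset.range (a.length + 1),
      X ^ (a.length - i) * f (upState a r i (a.length - i))
      + X ^ a.length * downPart f (a.length + 1) r
  | .D, (a, r) => ∑ i ∈ Finset.range a.length,
      X ^ (a.length - i) * f (upState a r i (a.length - i - 1))
      + X ^ a.length * downPart f a.length r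

/-- The action of a step of the upper path on the functions on the states. -/
noncomputable def tileOp (s : Step) :
    (State → ℤ[X]) →ₗ[ℤ[X]] (State → ℤ[X]) where
  toFun f := tileFun f s
  map_add' f g := by
    ext1 σ
    rcases σ with ⟨a, _ | ⟨b, r⟩⟩ <;> cases s <;>
      simp [tileFun, downPart, mul_add, Finset.sum_add_distrib] <;> abel
  map_smul' c f := by
    ext1 σ
    rcases σ with ⟨a, _ | ⟨b, r⟩⟩ <;> cases s <;>
      simp [tileFun, downPart, mul_add, Finset.mul_sum, mul_left_comm]

lemma tileOp_apply (s : Step) (f : State → ℤ[X]) (σ : State) :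
    tileOp s f σ = tileFun f s σ := rfl

/-- The term `f` comes from the run in which the lower path follows the upper one, up with all
levels continued and down again. Every other run of `UD` matches a run of `DU` with one level fewer
between the two steps; that extra level is new and topmost, and ends at once, whence the factor `X`.
-/
lemma tileOp_weyl (f : State → ℤ[X]) :
    tileOp .U (tileOp .D f) = f + (X : ℤ[X]) • tileOp .D (tileOp .U f) := by
  ext1 σ
  obtain ⟨a, r⟩ := σ
  have h1 : ∀ i ∈ Finset.range a.length,
      X ^ (a.length - i) * tileOp .D f (upState a r i (a.length - i))
      = X * (X ^ (a.length - i) * tileOp .U f (upState a r i (a.length - i - 1))) := by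
    intro i hi
    rw [Finset.mem_range] at hi
    obtain ⟨m, hm⟩ : ∃ m, a.length - i = m + 1 := ⟨a.length - i - 1, by omega⟩
    simp only [tileOp_apply, upState, tileFun, hm, length_freshGroup, Nat.add_sub_cancel, downPart]
    rw [mul_left_comm X]
    congr 1
    rw [mul_add, Finset.mul_sum, ← mul_assoc, ← pow_succ']
    congr 1
    refine Finset.sum_congr rfl fun j hj => ?_
    rw [Finset.mem_range] at hj
    rw [take_freshGroup _ _ (by omega), take_freshGroup _ _ (by omega), ← mul_assoc, ← pow_succ']
    congr 3
    · omega
    · congr 1; omega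
  have h2 : downPart (tileOp .D f) (a.length + 1) r = X * downPart (tileOp .U f) a.length r := by
    rcases r with _ | ⟨b, r⟩
    · simp [downPart]
    have h : ∀ i < b.length + a.length + 1, (b ++ freshGroup (a.length + 1)).take i
        = (b ++ freshGroup a.length).take i := by
      intro i hi
      rw [List.take_append, List.take_append, take_freshGroup _ _ (by omega),
        take_freshGroup _ _ (by omega)]
    simp only [downPart, downState, tileOp_apply, tileFun, List.length_append, length_freshGroup,
      upState]
    rw [mul_add, Finset.mul_sum, ← mul_assoc, ← pow_succ']
    congr 1
    refine Finset.sum_congr (by rw [add_assoc]) fun i hi => ?_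
    rw [Finset.mem_range] at hi
    rw [h i (by omega), ← mul_assoc, ← pow_succ']
    congr 3
    · omega
    · congr 1; omega
  have h3 : tileOp .D f (upState a r a.length 0) = f (a, r) := by
    simp [tileOp_apply, upState, freshGroup, tileFun, downPart, downState]
  rw [tileOp_apply, Pi.add_apply, Pi.smul_apply, tileOp_apply .D, tileFun, tileFun,
    Finset.sum_range_succ, Finset.sum_congr rfl h1, Nat.sub_self, h3, h2, ← Finset.mul_sum,
    smul_eq_mul]
  ring

/-! ### The parity conditions at the end of a tiling. -/

/-- Whether all groups of levels have even size. -/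
def evenGroups : List Bool → Bool
  | [] => true
  | [_] => false
  -- All groups are even exactly if the levels pair up consecutively within groups, so only the
  -- second flag of each pair matters.
  | _ :: y :: l => y && evenGroups l

lemma evenGroups_freshGroup (n : ℕ) : evenGroups (freshGroup n) = decide (Even n) := by
  rcases n with _ | n
  · simp [freshGroup, evenGroups]
  suffices ∀ m : ℕ, ∀ b, evenGroups (b :: List.replicate m true) = decide (Odd m) by
    rw [freshGroup, this]
    simp [Nat.even_add_one]
  intro m
  induction m using Nat.twoStepInduction with
  | zero => simp [evenGroups]
  | one => simp [evenGroups]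
  | more m ih _ =>
    intro b
    rw [List.replicate_succ, List.replicate_succ, evenGroups, ih]
    simp [Nat.odd_add, parity_simps]

lemma evenGroups_append_freshGroup (n : ℕ) : ∀ l : List Bool,
    evenGroups (l ++ freshGroup n) = (evenGroups l && decide (Even n))
  | [] => by simp [evenGroups, evenGroups_freshGroup]
  | [b] => by
    rcases n with _ | n <;> simp [freshGroup, evenGroups]
  | b :: c :: l => by
    simp [evenGroups, evenGroups_append_freshGroup n l, Bool.and_assoc]

/-- The condition on the levels below the current height `k`. -/
def GoodLevels (k : ℕ) (r : List (List Bool)) : Prop :=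
  evenGroups ((levels r).map Prod.snd) = true ∧ ∀ p ∈ levels r, Odd (k + p.1)

instance (k : ℕ) (r : List (List Bool)) : Decidable (GoodLevels k r) := by
  unfold GoodLevels; infer_instance

/-- The height of the block has the admissible parity, so the only constraint on the added group is
its size. -/
lemma goodLevels_cons_freshGroup (k n : ℕ) (b : List Bool) (r : List (List Bool))
    (hk : Odd (k + r.length)) :
    GoodLevels k ((b ++ freshGroup n) :: r) ↔ GoodLevels k (b :: r) ∧ Even n := by
  have h : ((levels ((b ++ freshGroup n) :: r)).map Prod.snd)
      = ((levels (b :: r)).map Prod.snd) ++ freshGroup n := by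
    simp [levels, Function.comp_def]
  unfold GoodLevels
  rw [h, evenGroups_append_freshGroup]
  simp only [levels, List.mem_append, List.mem_map, Bool.and_eq_true, decide_eq_true_eq]
  grind

/-- Here the height of the block has the wrong parity, which no level may have. -/
lemma goodLevels_cons (k : ℕ) (b : List Bool) (r : List (List Bool)) (hk : Even (k + r.length)) :
    GoodLevels k (b :: r) ↔ GoodLevels k r ∧ b = [] := by
  constructor
  · intro h
    have hb : b = [] := by
      rcases b with _ | ⟨c, b⟩
      · rfl
      · exact absurd hk (Nat.not_even_iff_odd.2 (h.2 (r.length, c) (by simp [levels])))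
    subst hb
    exact ⟨by simpa [GoodLevels, levels] using h, rfl⟩
  · rintro ⟨h, rfl⟩
    simpa [GoodLevels, levels] using h

/-- The final weight, for words of even length. -/
noncomputable def tileFin0 : State → ℤ[X]
  | (a, r) => if Even r.length ∧ GoodLevels (r.length + 1) (a :: r) then 1 else 0

/-- The final weight, for words of odd length. -/
noncomputable def tileFin : State → ℤ[X]
  | (a, r) => if Odd r.length ∧ GoodLevels r.length r then X ^ a.length else 0

lemma goodLevels_congr {k l : ℕ} (h : Even (k + l)) (r : List (List Bool)) :
    GoodLevels k r ↔ GoodLevels l r := by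
  unfold GoodLevels; grind

/-- `tileFin0` is the final weight after an up step of the lower path that continues all levels and
creates none. Every other term for `U` has one more level in the final top block than the
corresponding term for `D`; this level is one more Dyck tile and contributes the factor `X`. -/
lemma tileFin_U : tileOp .U tileFin = (X : ℤ[X]) • tileOp .D tileFin + tileFin0 := by
  ext1 ⟨a, r⟩
  have h1 : ∀ i < a.length,
      X ^ (a.length - i) * tileFin (upState a r i (a.length - i))
        = X * (X ^ (a.length - i) * tileFin (upState a r i (a.length - i - 1))) := by
    intro i hi
    simp only [tileFin, upState, length_freshGroup]
    by_cases h : Odd (List.take i a :: r).length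
        ∧ GoodLevels (List.take i a :: r).length (List.take i a :: r)
    · obtain ⟨m, hm⟩ : ∃ m, a.length - i = m + 1 := ⟨a.length - i - 1, by omega⟩
      rw [if_pos h, if_pos h, hm, Nat.add_sub_cancel]; ring
    · rw [if_neg h, if_neg h]; ring
  have h2 : downPart tileFin (a.length + 1) r = X * downPart tileFin a.length r := by
    rcases r with _ | ⟨b, r⟩
    · simp [downPart]
    · simp only [downPart, downState, tileFin, List.length_append, length_freshGroup]
      by_cases h : Odd r.length ∧ GoodLevels r.length r
      · rw [if_pos h, if_pos h]; ring
      · rw [if_neg h, if_neg h]; ring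
  have h3 : tileFin (upState a r a.length 0) = tileFin0 (a, r) := by
    simp only [tileFin, tileFin0, upState, freshGroup, List.length_nil, pow_zero, List.length_cons,
      List.take_length]
    exact if_congr (and_congr_left' (by simp [parity_simps])) rfl rfl
  rw [Pi.add_apply, Pi.smul_apply, tileOp_apply, tileOp_apply, tileFun, tileFun,
    Finset.sum_range_succ, Finset.sum_congr rfl fun i hi => h1 i (Finset.mem_range.1 hi),
    Nat.sub_self, h3, h2, ← Finset.mul_sum, smul_eq_mul]
  ring

lemma goodLevels_nil_cons (k : ℕ) (r : List (List Bool)) :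
    GoodLevels k ([] :: r) ↔ GoodLevels k r := by
  simp [GoodLevels, levels]

lemma tileFin0_upState (a : List Bool) (r : List (List Bool)) (i n : ℕ) :
    tileFin0 (upState a r i n) = if Odd r.length ∧ GoodLevels r.length r ∧ a.take i = [] ∧ Even n
      then 1 else 0 := by
  unfold tileFin0 upState
  refine if_congr ?_ rfl rfl
  simp only [List.length_cons, Nat.even_add_one, Nat.not_even_iff_odd]
  refine and_congr_right fun hr => ?_
  have := goodLevels_cons_freshGroup (r.length + 1 + 1) n [] (a.take i :: r)
    (by simp only [List.length_cons]; grind)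
  rw [List.nil_append] at this
  rw [this, goodLevels_nil_cons, goodLevels_cons _ _ _ (by grind),
    goodLevels_congr (l := r.length) (by grind), and_assoc]

lemma tileFin0_downState (b : List Bool) (r : List (List Bool)) (n : ℕ) :
    tileFin0 (downState b r n) = if Odd (b :: r).length ∧ GoodLevels (b :: r).length (b :: r)
      ∧ Even n then 1 else 0 := by
  unfold tileFin0 downState
  refine if_congr ?_ rfl rfl
  rw [goodLevels_cons_freshGroup _ _ _ _ (by grind)]
  exact and_congr_left' (by simp [parity_simps])

/-- Parity of the height forbids continuing a level of the top block. Two candidates remain, one for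
each step of the lower path, both of weight `X ^ a.length`; their numbers of new levels are
consecutive, so exactly one is even. -/
lemma tileFin0_eq (s : Step) : tileOp s tileFin0 = tileFin := by
  ext1 ⟨a, r⟩
  have h0 : ∀ (n : ℕ) i, i + 1 ≤ a.length → tileFin0 (upState a r (i + 1) n) = 0 := by
    intro n i hi
    rw [tileFin0_upState, if_neg]
    rintro ⟨-, -, h, -⟩
    have := congrArg List.length h
    rw [List.length_take, List.length_nil] at this
    omega
  rw [tileOp_apply]
  by_cases h : Odd r.length ∧ GoodLevels r.length r
  swap
  · have h1 : ∀ i n, tileFin0 (upState a r i n) = 0 := by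
      intro i n
      rw [tileFin0_upState, if_neg]
      exact fun h' => h ⟨h'.1, h'.2.1⟩
    have h2 : ∀ n, downPart tileFin0 n r = 0 := by
      intro n
      rcases r with _ | ⟨b, r⟩
      · rfl
      · rw [downPart, tileFin0_downState, if_neg]
        exact fun h' => h ⟨h'.1, h'.2.1⟩
    cases s <;> simp [tileFun, h1, h2, tileFin, h]
  have h2 : ∀ n, downPart tileFin0 n r = if Even n then 1 else 0 := by
    intro n
    rcases r with _ | ⟨b, r⟩
    · simp at h
    · rw [downPart, tileFin0_downState]
      exact if_congr (by tauto) rfl rfl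
  have h3 : tileFin (a, r) = X ^ a.length := if_pos h
  have h4 : ∀ n, tileFin0 (upState a r 0 n) = if Even n then 1 else 0 := by
    intro n
    rw [tileFin0_upState]
    exact if_congr (by simp [h]) rfl rfl
  cases s with
  | U =>
    rw [tileFun, Finset.sum_range_succ', Finset.sum_eq_zero, h2, h3, h4]
    · simp only [Nat.even_add_one, Nat.sub_zero]
      split_ifs <;> simp
    · intro i hi
      rw [h0 _ _ (Finset.mem_range.1 hi), mul_zero]
  | D =>
    -- With an empty top block a down step of the upper path leaves no room for an up step of the
    -- lower path: only the down term exists, and it creates `0` levels.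
    rcases a with _ | ⟨c, a⟩
    · simp [tileFun, h2, h3]
    · rw [tileFun, List.length_cons, Finset.sum_range_succ', Finset.sum_eq_zero, h2, h3, h4]
      · simp only [Nat.even_add_one, Nat.sub_zero, Nat.add_sub_cancel, List.length_cons]
        split_ifs <;> simp
      · intro i hi
        rw [h0 _ _ ?_, mul_zero]
        rw [Finset.mem_range] at hi
        simp only [List.length_cons]
        omega

/-- The step system of the tilings. -/
noncomputable def tileSystem : StepSystem State where
  op := tileOp
  vac := ([], [])
  fin := tileFin
  fin0 := tileFin0
  weyl := tileOp_weyl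
  vac_D f := by simp [tileOp_apply, tileFun, downPart]
  fin_U := tileFin_U
  fin0_eq := tileFin0_eq
  vac_U := by
    simp [tileOp_apply, tileFun, downPart, upState, tileFin, GoodLevels, freshGroup, levels,
      evenGroups]

/-! ### The step system of the diagrams -/

/-- The elements of `s` have the ranks `0, …, s.card - 1`. That counting from the other end gives
the same sum is what makes `nes` and `cr` equidistributed. -/
lemma sum_pow_card_lt {N : ℕ} (s : Finset (Fin N)) :
    ∑ i ∈ s, (X : ℤ[X]) ^ ({j ∈ s.erase i | j < i}).card = qNum s.card := by
  induction s using Finset.induction_on_max with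
  | empty => simp
  | insert a s h ih =>
    have ha : a ∉ s := fun h' => lt_irrefl _ (h a h')
    rw [Finset.sum_insert ha, Finset.card_insert_of_notMem ha, qNum_succ, ← ih, add_comm,
      Finset.erase_insert ha, Finset.filter_true_of_mem h]
    congr 1
    refine Finset.sum_congr rfl fun i hi => ?_
    rw [Finset.erase_insert_of_ne (h i hi).ne', Finset.filter_insert, if_neg (h i hi).not_gt]

lemma sum_pow_card_gt {N : ℕ} (s : Finset (Fin N)) :
    ∑ i ∈ s, (X : ℤ[X]) ^ ({j ∈ s.erase i | i < j}).card = qNum s.card := by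
  induction s using Finset.induction_on_min with
  | empty => simp
  | insert a s h ih =>
    have ha : a ∉ s := fun h' => lt_irrefl _ (h a h')
    rw [Finset.sum_insert ha, Finset.card_insert_of_notMem ha, qNum_succ, ← ih, add_comm,
      Finset.erase_insert ha, Finset.filter_true_of_mem h]
    congr 1
    refine Finset.sum_congr rfl fun i hi => ?_
    rw [Finset.erase_insert_of_ne (h i hi).ne, Finset.filter_insert, if_neg (h i hi).not_gt]

/-! ### Statistics of diagrams with open positions. -/

namespace Diagram

variable {N : ℕ}

/-- The indicator of a proposition. -/
def ind (p : Prop) [Decidable p] : ℕ := if p then 1 else 0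

/-- The weight of a pair of dashed arcs. -/
def dashDash (a b : Fin N × Fin N) : ℕ := 2 * ind (Nested a b) + ind (Crossing a b)

/-- The weight of a pair of arcs, for `nes` or for `cr`. -/
def arcArc (m : Bool) (a b : Fin N × Fin N) : ℕ :=
  if m then ind (Nested a b) else ind (Crossing a b)

/-- The weight of a dashed arc `a` and an arc `b`, for `nes` or for `cr`. -/
def dashArc (m : Bool) (a b : Fin N × Fin N) : ℕ :=
  ind (Crossing a b) + 2 * ind (Nested b a) + if m then ind (Nested a b) else ind (Crossing b a)

/-- The weight of a dashed arc and a diamond or an open position. -/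
def dashPoint (a : Fin N × Fin N) (d : Fin N) : ℕ :=
  ind (a.1 < d ∧ d < a.2) + 2 * ind (d < a.1)

/-- The weight of an arc and an open position. -/
def arcOpen (m : Bool) (a : Fin N × Fin N) (o : Fin N) : ℕ :=
  if m then ind (o < a.1) else ind (a.1 < o ∧ o < a.2)

/-- The statistics `nes` and `cr` for a diagram with a set of open positions. -/
def stat (m : Bool) (A D : Finset (Fin N × Fin N)) (M O : Finset (Fin N)) : ℕ :=
  ∑ a ∈ D, ∑ b ∈ D, dashDash a b + ∑ a ∈ D, ∑ b ∈ A, dashArc m a b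
    + ∑ a ∈ A, ∑ b ∈ A, arcArc m a b + ∑ a ∈ D, ∑ d ∈ M, dashPoint a d
    + ∑ a ∈ A, ∑ d ∈ M, ind (d < a.1) + ∑ a ∈ D, ∑ o ∈ O, dashPoint a o
    + ∑ a ∈ A, ∑ o ∈ O, arcOpen m a o + ∑ d ∈ M, ∑ o ∈ O, ind (d < o)

lemma sum_one (i : Fin N) : ∑ j, one i j = 1 := by simp [one]

lemma sum_ite_one (p : Prop) [Decidable p] (i : Fin N) :
    ∑ j, (if p then one i else 0) j = ind p := by
  unfold ind; split_ifs <;> simp [sum_one]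

lemma sum_ite_one_add_one (p : Prop) [Decidable p] (i i' : Fin N) :
    ∑ j, (if p then one i + one i' else 0) j = 2 * ind p := by
  unfold ind; split_ifs <;> simp [sum_one, Finset.sum_add_distrib]

lemma sum_sum_sum_apply {α β : Type*} (s : Finset α) (t : Finset β) (f : α → β → Fin N → ℕ) :
    ∑ j, (∑ a ∈ s, ∑ b ∈ t, f a b) j = ∑ a ∈ s, ∑ b ∈ t, ∑ j, f a b j := by
  simp only [Finset.sum_apply]
  rw [Finset.sum_comm]
  exact Finset.sum_congr rfl fun a _ => Finset.sum_comm

lemma sum_add_apply (f g : Fin N → ℕ) : ∑ j, (f + g) j = ∑ j, f j + ∑ j, g j := by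
  simp [Finset.sum_add_distrib]

lemma nes_eq_stat (π : Diagram N) : π.nes = stat true π.arcs π.dashed π.diamonds ∅ := by
  simp only [nes, nesSeq, commonSeq, sum_add_apply, sum_sum_sum_apply, sum_ite_one,
    sum_ite_one_add_one, stat, dashDash, dashArc, arcArc, dashPoint, Finset.sum_add_distrib,
    Finset.sum_empty, Finset.sum_const_zero, if_true]
  rw [Finset.sum_comm (s := π.arcs) (t := π.dashed)]
  ring

lemma cr_eq_stat (π : Diagram N) : π.cr = stat false π.arcs π.dashed π.diamonds ∅ := by
  simp only [cr, crSeq, commonSeq, sum_add_apply, sum_sum_sum_apply, sum_ite_one,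
    sum_ite_one_add_one, stat, dashDash, dashArc, arcArc, dashPoint, Finset.sum_add_distrib,
    Finset.sum_empty, Finset.sum_const_zero, if_false, Bool.false_eq_true]
  rw [Finset.sum_comm (s := π.arcs) (t := π.dashed), Finset.sum_comm (s := π.arcs) (t := π.dashed)]
  ring

/-- All the positions of a diagram with open positions are less than `k`. -/
structure Before (k : Fin N) (A D : Finset (Fin N × Fin N)) (M O : Finset (Fin N)) : Prop where
  arc : ∀ a ∈ A, a.1 < a.2 ∧ a.2 < k
  dash : ∀ a ∈ D, a.1 < a.2 ∧ a.2 < k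
  diamond : ∀ d ∈ M, d < k
  opn : ∀ o ∈ O, o < k

variable {k o : Fin N} {A D : Finset (Fin N × Fin N)} {M O : Finset (Fin N)} (m : Bool)

/-- Everything present lies to the left of `k`, so the new open position interacts only with the
diamonds: whether it becomes the left end of an arc or an end of a dashed arc, a diamond on its left
costs `1` for it. -/
lemma stat_insert_open (h : Before k A D M O) :
    stat m A D M (insert k O) = stat m A D M O + M.card := by
  have hk : k ∉ O := fun h' => lt_irrefl _ (h.opn k h')
  have h1 : ∀ a ∈ D, dashPoint a k = 0 := by
    intro a ha
    have := h.dash a ha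
    simp [dashPoint, ind, this.2.not_gt, (this.1.trans this.2).not_gt]
  have h2 : ∀ a ∈ A, arcOpen m a k = 0 := by
    intro a ha
    have := h.arc a ha
    simp [arcOpen, ind, this.2.not_gt, (this.1.trans this.2).not_gt]
  have h3 : ∀ d ∈ M, ind (d < k) = 1 := fun d hd => by simp [ind, h.diamond d hd]
  simp only [stat, Finset.sum_insert hk, Finset.sum_add_distrib, Finset.sum_congr rfl h1,
    Finset.sum_congr rfl h2, Finset.sum_congr rfl h3, Finset.sum_const_zero, Finset.sum_const,
    smul_eq_mul, mul_one]
  ring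

lemma stat_singleton_diamond (h : Before k A D ∅ O) :
    stat m A D {k} O = stat m A D ∅ O := by
  have h1 : ∀ a ∈ D, dashPoint a k = 0 := by
    intro a ha
    have := h.dash a ha
    simp [dashPoint, ind, this.2.not_gt, (this.1.trans this.2).not_gt]
  have h2 : ∀ a ∈ A, ind (k < a.1) = 0 := by
    intro a ha
    have := h.arc a ha
    simp [ind, (this.1.trans this.2).not_gt]
  have h3 : ∀ d ∈ O, ind (k < d) = 0 := fun d hd => by simp [ind, (h.opn d hd).not_gt]
  simp only [stat, Finset.sum_singleton, Finset.sum_congr rfl h1,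
    Finset.sum_congr rfl h2, Finset.sum_congr rfl h3, Finset.sum_const_zero, Finset.sum_empty]

/-- An open position already carries the weights that its arc will have with the arcs, dashed arcs
and diamonds present, so only the other open positions count. Their arcs will end after `k`: those
starting left of `o` enclose the new arc, those starting between `o` and `k` cross it. -/
lemma stat_insert_arc (h : Before k A D M (insert o O)) (ho : o ∉ O) :
    stat m (insert (o, k) A) D M O = stat m A D M (insert o O)
      + if m then ({j ∈ O | j < o}).card else ({j ∈ O | o < j}).card := by
  have hA : (o, k) ∉ A := fun h' => lt_irrefl _ (h.arc _ h').2
  have hk : o < k := h.opn o (Finset.mem_insert_self _ _)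
  have h1 : ∀ a ∈ D, dashArc m a (o, k) = dashPoint a o := by
    intro a ha
    have := h.dash a ha
    simp only [dashArc, dashPoint, ind, Nested, Crossing]
    grind
  have h2 : ∀ a ∈ A, arcOpen m a o = arcArc m (o, k) a + arcArc m a (o, k) := by
    intro a ha
    have := h.arc a ha
    simp only [arcArc, arcOpen, ind, Nested, Crossing]
    grind
  have h3 : arcArc m (o, k) (o, k) = 0 := by
    simp [arcArc, ind, Nested, Crossing]
  have h4 : ∑ j ∈ O, arcOpen m (o, k) j
      = if m then ({j ∈ O | j < o}).card else ({j ∈ O | o < j}).card := by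
    have : ∀ j ∈ O, (o < j ∧ j < k ↔ o < j) := fun j hj => by
      simp [h.opn j (Finset.mem_insert_of_mem hj)]
    cases m
    · simp [arcOpen, ind, Finset.sum_boole, Finset.filter_congr this]
    · simp [arcOpen, ind, Finset.sum_boole]
  simp only [stat, Finset.sum_insert hA, Finset.sum_insert ho, Finset.sum_add_distrib,
    Finset.sum_congr rfl h1, Finset.sum_congr rfl h2, h3, h4]
  ring

/-- Any other open position or diamond lies under the dashed arc, at cost `1`, or to its left, at
cost `2`. For open positions this does not depend on how they are closed later, nor on the choice of
`nes` or `cr`. -/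
lemma stat_insert_dash (h : Before k A D M (insert o O)) (ho : o ∉ O) (hM : o ∉ M) :
    stat m A (insert (o, k) D) M O = stat m A D M (insert o O)
      + (M.card + O.card + ({j ∈ O | j < o}).card) := by
  have hA : (o, k) ∉ D := fun h' => lt_irrefl _ (h.dash _ h').2
  have hk : o < k := h.opn o (Finset.mem_insert_self _ _)
  have h1 : ∀ a ∈ D, dashPoint a o = dashDash (o, k) a + dashDash a (o, k) := by
    intro a ha
    have := h.dash a ha
    simp only [dashDash, dashPoint, ind, Nested, Crossing]
    grind
  have h2 : ∀ a ∈ A, dashArc m (o, k) a = arcOpen m a o := by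
    intro a ha
    have := h.arc a ha
    simp only [dashArc, arcOpen, ind, Nested, Crossing]
    grind
  have h3 : dashDash (o, k) (o, k) = 0 := by
    simp [dashDash, ind, Nested, Crossing]
  have h4 : ∑ j ∈ O, dashPoint (o, k) j = O.card + ({j ∈ O | j < o}).card := by
    have : ∀ j ∈ O, dashPoint (o, k) j = 1 + ind (j < o) := fun j hj => by
      have := h.opn j (Finset.mem_insert_of_mem hj)
      have : j ≠ o := fun h' => ho (h' ▸ hj)
      simp only [dashPoint, ind]
      grind
    rw [Finset.sum_congr rfl this]
    simp [ind, Finset.sum_add_distrib, Finset.sum_boole]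
  have h5 : ∑ j ∈ M, dashPoint (o, k) j = M.card + ∑ j ∈ M, ind (j < o) := by
    have : ∀ j ∈ M, dashPoint (o, k) j = 1 + ind (j < o) := fun j hj => by
      have := h.diamond j hj
      have : j ≠ o := fun h' => hM (h' ▸ hj)
      simp only [dashPoint, ind]
      grind
    rw [Finset.sum_congr rfl this]
    simp [Finset.sum_add_distrib]
  simp only [stat, Finset.sum_insert hA, Finset.sum_insert ho, Finset.sum_add_distrib,
    Finset.sum_congr rfl h1, Finset.sum_congr rfl h2, h3, h4, h5]
  ring

end Diagram

/-! ### Partial matchings and the action of a down step. -/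

namespace Diagram

variable {N : ℕ}

/-- The number of arcs, dashed arcs, diamonds and open marks at a position. -/
def coverage (A D : Finset (Fin N × Fin N)) (M O : Finset (Fin N)) (i : Fin N) : ℕ :=
  ({a ∈ A | a.1 = i ∨ a.2 = i}).card + ({a ∈ D | a.1 = i ∨ a.2 = i}).card
    + ({j ∈ M | j = i}).card + ({j ∈ O | j = i}).card

/-- The diagram with arcs `A`, dashed arcs `D`, diamonds `M` and open positions `O` is a partial
matching on the first `k` positions of `u`. -/
structure IsPartial (u : Path N) (k : ℕ) (A D : Finset (Fin N × Fin N)) (M O : Finset (Fin N)) :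
    Prop where
  arc : ∀ a ∈ A, a.1 < a.2 ∧ u a.1 = .U ∧ u a.2 = .D
  dash : ∀ a ∈ D, a.1 < a.2 ∧ u a.1 = .U ∧ u a.2 = .U
  diamond : ∀ i ∈ M, u i = .U
  opn : ∀ i ∈ O, u i = .U
  card_le : M.card ≤ 1
  perfect : ∀ i, coverage A D M O i = if i.val < k then 1 else 0

variable {u : Path N} {k : Fin N} {A D : Finset (Fin N × Fin N)} {M O : Finset (Fin N)}

lemma coverage_eq_zero {i : Fin N} : coverage A D M O i = 0 ↔
    (∀ a ∈ A, a.1 ≠ i ∧ a.2 ≠ i) ∧ (∀ a ∈ D, a.1 ≠ i ∧ a.2 ≠ i) ∧ i ∉ M ∧ i ∉ O := by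
  simp only [coverage, Nat.add_eq_zero_iff, Finset.card_eq_zero, Finset.filter_eq_empty_iff,
    not_or]
  constructor
  · rintro ⟨⟨⟨h1, h2⟩, h3⟩, h4⟩
    exact ⟨h1, h2, fun h => h3 h rfl, fun h => h4 h rfl⟩
  · rintro ⟨h1, h2, h3, h4⟩
    exact ⟨⟨⟨h1, h2⟩, fun j hj h => h3 (h ▸ hj)⟩, fun j hj h => h4 (h ▸ hj)⟩

lemma coverage_insert_open {o : Fin N} (ho : o ∉ O) (i : Fin N) :
    coverage A D M (insert o O) i = coverage A D M O i + if o = i then 1 else 0 := by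
  unfold coverage
  rw [Finset.filter_insert]
  split_ifs
  · rw [Finset.card_insert_of_notMem (by simp [ho])]; rfl
  · rfl

lemma coverage_insert_diamond {o : Fin N} (ho : o ∉ M) (i : Fin N) :
    coverage A D (insert o M) O i = coverage A D M O i + if o = i then 1 else 0 := by
  unfold coverage
  rw [Finset.filter_insert]
  split_ifs
  · rw [Finset.card_insert_of_notMem (by simp [ho])]; ring
  · rfl

lemma coverage_insert_arc {a : Fin N × Fin N} (ha : a ∉ A) (i : Fin N) :
    coverage (insert a A) D M O i
      = coverage A D M O i + if a.1 = i ∨ a.2 = i then 1 else 0 := by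
  unfold coverage
  rw [Finset.filter_insert]
  split_ifs
  · rw [Finset.card_insert_of_notMem (by simp [ha])]; ring
  · rfl

lemma coverage_insert_dash {a : Fin N × Fin N} (ha : a ∉ D) (i : Fin N) :
    coverage A (insert a D) M O i
      = coverage A D M O i + if a.1 = i ∨ a.2 = i then 1 else 0 := by
  unfold coverage
  rw [Finset.filter_insert]
  split_ifs
  · rw [Finset.card_insert_of_notMem (by simp [ha])]; ring
  · rfl

namespace IsPartial

lemma before (h : IsPartial u k A D M O) : Before k A D M O := by
  have h0 : ∀ i : Fin N, ¬ i < k → coverage A D M O i = 0 := fun i hi => by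
    rw [h.perfect]; exact if_neg hi
  refine ⟨fun a ha => ⟨(h.arc a ha).1, ?_⟩, fun a ha => ⟨(h.dash a ha).1, ?_⟩, fun d hd => ?_,
    fun d hd => ?_⟩ <;> by_contra hc <;> have := coverage_eq_zero.1 (h0 _ hc)
  · exact (this.1 a ha).2 rfl
  · exact (this.2.1 a ha).2 rfl
  · exact this.2.2.1 hd
  · exact this.2.2.2 hd

lemma insert_open_iff (hO : k ∉ O) (hk : u k = .U) :
    IsPartial u (k + 1) A D M (insert k O) ↔ IsPartial u k A D M O := by
  have hc : ∀ i, coverage A D M (insert k O) i = (if i.val < k + 1 then 1 else 0) ↔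
      coverage A D M O i = if i.val < k then 1 else 0 := by
    intro i
    rw [coverage_insert_open hO]
    simp only [Fin.ext_iff]
    split_ifs <;> omega
  constructor
  · intro h
    exact ⟨h.arc, h.dash, h.diamond, fun i hi => h.opn i (Finset.mem_insert_of_mem hi), h.card_le,
      fun i => (hc i).1 (h.perfect i)⟩
  · intro h
    refine ⟨h.arc, h.dash, h.diamond, fun i hi => ?_, h.card_le, fun i => (hc i).2 (h.perfect i)⟩
    rcases Finset.mem_insert.1 hi with rfl | hi
    · exact hk
    · exact h.opn i hi

lemma singleton_diamond_iff (hk : u k = .U) :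
    IsPartial u (k + 1) A D {k} O ↔ IsPartial u k A D ∅ O := by
  have hc : ∀ i, coverage A D {k} O i = (if i.val < k + 1 then 1 else 0) ↔
      coverage A D ∅ O i = if i.val < k then 1 else 0 := by
    intro i
    rw [← insert_empty_eq, coverage_insert_diamond (Finset.notMem_empty _)]
    simp only [Fin.ext_iff]
    split_ifs <;> omega
  constructor
  · intro h
    exact ⟨h.arc, h.dash, by simp, h.opn, by simp, fun i => (hc i).1 (h.perfect i)⟩
  · intro h
    exact ⟨h.arc, h.dash, by simpa using hk, h.opn, by simp, fun i => (hc i).2 (h.perfect i)⟩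

lemma insert_arc_iff {o : Fin N} (hok : o < k) (hA : (o, k) ∉ A) (hO : o ∉ O) (hk : u k = .D) :
    IsPartial u (k + 1) (insert (o, k) A) D M O ↔ IsPartial u k A D M (insert o O) := by
  have hc : ∀ i, coverage (insert (o, k) A) D M O i = (if i.val < k + 1 then 1 else 0) ↔
      coverage A D M (insert o O) i = if i.val < k then 1 else 0 := by
    intro i
    rw [coverage_insert_arc hA, coverage_insert_open hO]
    simp only [Fin.ext_iff]
    rw [Fin.lt_def] at hok
    split_ifs <;> omega
  constructor
  · intro h
    refine ⟨fun a ha => h.arc a (Finset.mem_insert_of_mem ha), h.dash, h.diamond, fun i hi => ?_,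
      h.card_le, fun i => (hc i).1 (h.perfect i)⟩
    rcases Finset.mem_insert.1 hi with rfl | hi
    · exact (h.arc _ (Finset.mem_insert_self _ _)).2.1
    · exact h.opn i hi
  · intro h
    refine ⟨fun a ha => ?_, h.dash, h.diamond, fun i hi => h.opn i (Finset.mem_insert_of_mem hi),
      h.card_le, fun i => (hc i).2 (h.perfect i)⟩
    rcases Finset.mem_insert.1 ha with rfl | ha
    · exact ⟨hok, h.opn _ (Finset.mem_insert_self _ _), hk⟩
    · exact h.arc a ha

lemma insert_dash_iff {o : Fin N} (hok : o < k) (hD : (o, k) ∉ D) (hO : o ∉ O) (hk : u k = .U) :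
    IsPartial u (k + 1) A (insert (o, k) D) M O ↔ IsPartial u k A D M (insert o O) := by
  have hc : ∀ i, coverage A (insert (o, k) D) M O i = (if i.val < k + 1 then 1 else 0) ↔
      coverage A D M (insert o O) i = if i.val < k then 1 else 0 := by
    intro i
    rw [coverage_insert_dash hD, coverage_insert_open hO]
    simp only [Fin.ext_iff]
    rw [Fin.lt_def] at hok
    split_ifs <;> omega
  constructor
  · intro h
    refine ⟨h.arc, fun a ha => h.dash a (Finset.mem_insert_of_mem ha), h.diamond, fun i hi => ?_,
      h.card_le, fun i => (hc i).1 (h.perfect i)⟩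
    rcases Finset.mem_insert.1 hi with rfl | hi
    · exact (h.dash _ (Finset.mem_insert_self _ _)).2.1
    · exact h.opn i hi
  · intro h
    refine ⟨h.arc, fun a ha => ?_, h.diamond, fun i hi => h.opn i (Finset.mem_insert_of_mem hi),
      h.card_le, fun i => (hc i).2 (h.perfect i)⟩
    rcases Finset.mem_insert.1 ha with rfl | ha
    · exact ⟨hok, h.opn _ (Finset.mem_insert_self _ _), hk⟩
    · exact h.dash a ha

/-- The last position of a partial matching is at the right end of an arc or of a dashed arc, or
it is a diamond, or it is open. -/
lemma last (h : IsPartial u (k + 1) A D M O) :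
    (∃ o < k, (o, k) ∈ A) ∨ (∃ o < k, (o, k) ∈ D) ∨ k ∈ M ∨ k ∈ O := by
  have h1 : coverage A D M O k ≠ 0 := by
    rw [h.perfect, if_pos (Nat.lt_succ_self _)]; exact one_ne_zero
  have h2 : ∀ i : Fin N, k < i → coverage A D M O i = 0 := fun i hi => by
    rw [h.perfect, if_neg (by rw [Fin.lt_def] at hi; omega)]
  by_contra! hc
  refine h1 (coverage_eq_zero.2 ⟨fun a ha => ⟨?_, ?_⟩, fun a ha => ⟨?_, ?_⟩, hc.2.2.1, hc.2.2.2⟩)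
  · rintro rfl
    exact ((coverage_eq_zero.1 (h2 _ (h.arc a ha).1)).1 a ha).2 rfl
  · rintro rfl
    exact hc.1 a.1 (h.arc a ha).1 ha
  · rintro rfl
    exact ((coverage_eq_zero.1 (h2 _ (h.dash a ha).1)).2.1 a ha).2 rfl
  · rintro rfl
    exact hc.2.1 a.1 (h.dash a ha).1 ha

end IsPartial

/-- A diagram with a set of open positions. -/
abbrev OpenDiagram (N : ℕ) := Diagram N × Finset (Fin N)

open Classical in
/-- The partial matchings on the first `k` positions. -/
noncomputable def partials (u : Path N) (k : ℕ) : Finset (OpenDiagram N) :=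
  {p | IsPartial u k p.1.1 p.1.2.1 p.1.2.2 p.2}

lemma mem_partials {k : ℕ} {p : OpenDiagram N} :
    p ∈ partials u k ↔ IsPartial u k p.1.1 p.1.2.1 p.1.2.2 p.2 := by simp [partials]

/-- The contribution of a diagram with open positions to a generating function. -/
noncomputable def weight (m : Bool) (f : ℕ × ℕ → ℤ[X]) (p : OpenDiagram N) : ℤ[X] :=
  X ^ stat m p.1.1 p.1.2.1 p.1.2.2 p.2 * f (p.2.card, p.1.2.2.card)

lemma sum_pow_rank (m : Bool) (s : Finset (Fin N)) :
    ∑ i ∈ s, (X : ℤ[X]) ^ (if m then ({j ∈ s.erase i | j < i}).card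
      else ({j ∈ s.erase i | i < j}).card) = qNum s.card := by
  cases m
  · exact sum_pow_card_gt s
  · exact sum_pow_card_lt s

/-- A down step closes one of the open positions by an arc. Pairs of a partial matching and one of
its open positions correspond to partial matchings one position longer, and the costs of the choices
sum to `[h]`. -/
lemma sum_partials_D (m : Bool) (f : ℕ × ℕ → ℤ[X]) (hk : u k = .D) :
    ∑ p ∈ partials u (k + 1), weight m f p
      = ∑ p ∈ partials u k, weight m (markedOp .D f) p := by
  have h1 : ∀ p ∈ partials u k, weight m (markedOp .D f) p
      = ∑ o ∈ p.2, weight m f ((insert (o, k) p.1.1, p.1.2), p.2.erase o) := by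
    intro p hp
    rw [mem_partials] at hp
    have : markedOp .D f (p.2.card, p.1.2.2.card)
      = qNum p.2.card * f (p.2.card - 1, p.1.2.2.card) := rfl
    rw [weight, this, ← sum_pow_rank m, Finset.sum_mul, Finset.mul_sum]
    refine Finset.sum_congr rfl fun o ho => ?_
    have hB := hp.before
    rw [← Finset.insert_erase ho] at hB
    rw [weight, stat_insert_arc m hB (Finset.notMem_erase _ _), Finset.insert_erase ho,
      Finset.card_erase_of_mem ho, pow_add]
    ring
  rw [Finset.sum_congr rfl h1, Finset.sum_sigma']
  symm
  refine Finset.sum_bij (fun x _ => ((insert (x.2, k) x.1.1.1, x.1.1.2), x.1.2.erase x.2))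
    ?_ ?_ ?_ (fun _ _ => rfl)
  · rintro ⟨⟨⟨A, D, M⟩, O⟩, o⟩ h
    simp only [Finset.mem_sigma, mem_partials] at h ⊢
    have hB := h.1.before
    rw [IsPartial.insert_arc_iff (hB.opn o h.2) (fun h' => (hB.arc _ h').2.ne rfl)
      (Finset.notMem_erase _ _) hk, Finset.insert_erase h.2]
    exact h.1
  · rintro ⟨⟨⟨A, D, M⟩, O⟩, o⟩ h ⟨⟨⟨A', D', M'⟩, O'⟩, o'⟩ h' he
    simp only [Finset.mem_sigma, mem_partials, Prod.mk.injEq] at h h' he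
    obtain ⟨⟨h1, rfl, rfl⟩, h2⟩ := he
    have hA : ∀ j, (j, k) ∉ A := fun j hj => (h.1.before.arc _ hj).2.ne rfl
    have hA' : ∀ j, (j, k) ∉ A' := fun j hj => (h'.1.before.arc _ hj).2.ne rfl
    have ho : (o, k) ∈ insert (o', k) A' := h1 ▸ Finset.mem_insert_self _ _
    obtain rfl : o = o' := by
      rcases Finset.mem_insert.1 ho with ho | ho
      · exact congrArg Prod.fst ho
      · exact absurd ho (hA' o)
    obtain rfl : A = A' := by
      rw [← Finset.erase_insert (hA o), h1, Finset.erase_insert (hA' o)]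
    obtain rfl : O = O' := by
      rw [← Finset.insert_erase h.2, h2, Finset.insert_erase h'.2]
    rfl
  · rintro ⟨⟨A, D, M⟩, O⟩ h
    rw [mem_partials] at h
    obtain ⟨o, hok, ho⟩ : ∃ o < k, (o, k) ∈ A := by
      rcases h.last with h' | ⟨o, -, ho⟩ | h' | h'
      · exact h'
      · exact absurd ((h.dash _ ho).2.2.symm.trans hk) (by simp)
      · exact absurd ((h.diamond _ h').symm.trans hk) (by simp)
      · exact absurd ((h.opn _ h').symm.trans hk) (by simp)
    -- The arc covers `o` already, and coverage is at most `1`.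
    have hO : o ∉ O := fun hO => by
      have h1 := h.perfect o
      rw [← Finset.insert_erase ho, ← Finset.insert_erase hO,
        coverage_insert_arc (Finset.notMem_erase _ _),
        coverage_insert_open (Finset.notMem_erase _ _)] at h1
      simp only [true_or, if_true] at h1
      split_ifs at h1
      all_goals omega
    refine ⟨⟨⟨⟨A.erase (o, k), D, M⟩, insert o O⟩, o⟩, ?_, ?_⟩
    · simp only [Finset.mem_sigma, mem_partials, Finset.mem_insert_self, and_true]
      rw [← IsPartial.insert_arc_iff hok (Finset.notMem_erase _ _) hO hk, Finset.insert_erase ho]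
      exact h
    · simp only [Finset.insert_erase ho, Finset.erase_insert hO]

end Diagram

/-! ### The action of an up step, and the sum over all matchings. -/

namespace Diagram

variable {N : ℕ} {u : Path N} {k : Fin N}

/-- An up step that is neither left open nor a diamond ends a dashed arc. The cost `e + (h - 1) +
rank` of closing an open position, with `e` diamonds, sums to `q^(e+h-1) [h]`. -/
lemma sum_partials_dash (m : Bool) (f : ℕ × ℕ → ℤ[X]) (hk : u k = .U) :
    ∑ p ∈ partials u (k + 1) with k ∉ p.2 ∧ k ∉ p.1.2.2, weight m f p
      = ∑ p ∈ partials u k, X ^ stat m p.1.1 p.1.2.1 p.1.2.2 p.2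
          * (X ^ (p.1.2.2.card + p.2.card - 1) * qNum p.2.card
            * f (p.2.card - 1, p.1.2.2.card)) := by
  have h1 : ∀ p ∈ partials u k, X ^ stat m p.1.1 p.1.2.1 p.1.2.2 p.2
          * (X ^ (p.1.2.2.card + p.2.card - 1) * qNum p.2.card
            * f (p.2.card - 1, p.1.2.2.card))
      = ∑ o ∈ p.2, weight m f ((p.1.1, insert (o, k) p.1.2.1, p.1.2.2), p.2.erase o) := by
    intro p hp
    rw [mem_partials] at hp
    rw [← sum_pow_card_lt, Finset.mul_sum, Finset.sum_mul, Finset.mul_sum]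
    refine Finset.sum_congr rfl fun o ho => ?_
    have hM : o ∉ p.1.2.2 := fun hM => by
      have h1 := hp.perfect o
      rw [← Finset.insert_erase hM, ← Finset.insert_erase ho,
        coverage_insert_diamond (Finset.notMem_erase _ _),
        coverage_insert_open (Finset.notMem_erase _ _)] at h1
      simp only [if_true] at h1
      split_ifs at h1
      all_goals omega
    have hB := hp.before
    rw [← Finset.insert_erase ho] at hB
    have hc : p.2.card = (p.2.erase o).card + 1 := (Finset.card_erase_add_one ho).symm
    rw [weight, stat_insert_dash m hB (Finset.notMem_erase _ _) hM, Finset.insert_erase ho, hc,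
      ← add_assoc, Nat.add_sub_cancel, Nat.add_sub_cancel, pow_add, pow_add]
    ring
  rw [Finset.sum_congr rfl h1, Finset.sum_sigma']
  symm
  refine Finset.sum_bij (fun x _ => ((x.1.1.1, insert (x.2, k) x.1.1.2.1, x.1.1.2.2),
    x.1.2.erase x.2)) ?_ ?_ ?_ (fun _ _ => rfl)
  · rintro ⟨⟨⟨A, D, M⟩, O⟩, o⟩ h
    simp only [Finset.mem_sigma, mem_partials, Finset.mem_filter] at h ⊢
    have hB := h.1.before
    rw [IsPartial.insert_dash_iff (hB.opn o h.2) (fun h' => (hB.dash _ h').2.ne rfl)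
      (Finset.notMem_erase _ _) hk, Finset.insert_erase h.2]
    exact ⟨h.1, fun h' => (hB.opn _ (Finset.mem_of_mem_erase h')).ne rfl,
      fun h' => (hB.diamond _ h').ne rfl⟩
  · rintro ⟨⟨⟨A, D, M⟩, O⟩, o⟩ h ⟨⟨⟨A', D', M'⟩, O'⟩, o'⟩ h' he
    simp only [Finset.mem_sigma, mem_partials, Prod.mk.injEq] at h h' he
    obtain ⟨⟨rfl, h1, rfl⟩, h2⟩ := he
    have hD : ∀ j, (j, k) ∉ D := fun j hj => (h.1.before.dash _ hj).2.ne rfl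
    have hD' : ∀ j, (j, k) ∉ D' := fun j hj => (h'.1.before.dash _ hj).2.ne rfl
    have ho : (o, k) ∈ insert (o', k) D' := h1 ▸ Finset.mem_insert_self _ _
    obtain rfl : o = o' := by
      rcases Finset.mem_insert.1 ho with ho | ho
      · exact congrArg Prod.fst ho
      · exact absurd ho (hD' o)
    obtain rfl : D = D' := by
      rw [← Finset.erase_insert (hD o), h1, Finset.erase_insert (hD' o)]
    obtain rfl : O = O' := by
      rw [← Finset.insert_erase h.2, h2, Finset.insert_erase h'.2]
    rfl
  · rintro ⟨⟨A, D, M⟩, O⟩ h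
    rw [Finset.mem_filter, mem_partials] at h
    obtain ⟨h, hkO, hkM⟩ := h
    obtain ⟨o, hok, ho⟩ : ∃ o < k, (o, k) ∈ D := by
      rcases h.last with ⟨o, -, ho⟩ | h' | h' | h'
      · exact absurd ((h.arc _ ho).2.2.symm.trans hk) (by simp)
      · exact h'
      · exact absurd h' hkM
      · exact absurd h' hkO
    have hO : o ∉ O := fun hO => by
      have h1 := h.perfect o
      rw [← Finset.insert_erase ho, ← Finset.insert_erase hO,
        coverage_insert_dash (Finset.notMem_erase _ _),
        coverage_insert_open (Finset.notMem_erase _ _)] at h1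
      simp only [true_or, if_true] at h1
      split_ifs at h1
      all_goals omega
    refine ⟨⟨⟨⟨A, D.erase (o, k), M⟩, insert o O⟩, o⟩, ?_, ?_⟩
    · simp only [Finset.mem_sigma, mem_partials, Finset.mem_insert_self, and_true]
      rw [← IsPartial.insert_dash_iff hok (Finset.notMem_erase _ _) hO hk, Finset.insert_erase ho]
      exact h
    · simp only [Finset.insert_erase ho, Finset.erase_insert hO]

lemma sum_partials_open (m : Bool) (f : ℕ × ℕ → ℤ[X]) (hk : u k = .U) :
    ∑ p ∈ partials u (k + 1) with k ∈ p.2, weight m f p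
      = ∑ p ∈ partials u k, X ^ stat m p.1.1 p.1.2.1 p.1.2.2 p.2
          * (X ^ p.1.2.2.card * f (p.2.card + 1, p.1.2.2.card)) := by
  symm
  have hkO : ∀ p ∈ partials u k, k ∉ p.2 := fun p hp h =>
    ((mem_partials.1 hp).before.opn _ h).ne rfl
  refine Finset.sum_bij' (fun p _ => (p.1, insert k p.2)) (fun p _ => (p.1, p.2.erase k))
    ?_ ?_ ?_ ?_ ?_
  · intro p hp
    rw [Finset.mem_filter, mem_partials]
    exact ⟨(IsPartial.insert_open_iff (hkO p hp) hk).2 (mem_partials.1 hp),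
      Finset.mem_insert_self _ _⟩
  · intro p hp
    rw [Finset.mem_filter, mem_partials] at hp
    rw [mem_partials, ← IsPartial.insert_open_iff (Finset.notMem_erase _ _) hk,
      Finset.insert_erase hp.2]
    exact hp.1
  · intro p hp
    simp [Finset.erase_insert (hkO p hp)]
  · intro p hp
    rw [Finset.mem_filter] at hp
    simp [Finset.insert_erase hp.2]
  · intro p hp
    rw [weight, stat_insert_open m (mem_partials.1 hp).before,
      Finset.card_insert_of_notMem (hkO p hp), pow_add]
    ring

/-- As at most one diamond is allowed, a diamond at `k` is the only one, and removing it leaves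
exactly the partial matchings without diamonds. -/
lemma sum_partials_diamond (m : Bool) (f : ℕ × ℕ → ℤ[X]) (hk : u k = .U) :
    ∑ p ∈ partials u (k + 1) with k ∉ p.2 ∧ k ∈ p.1.2.2, weight m f p
      = ∑ p ∈ partials u k, X ^ stat m p.1.1 p.1.2.1 p.1.2.2 p.2
          * (if p.1.2.2.card = 0 then f (p.2.card, 1) else 0) := by
  symm
  simp only [mul_ite, mul_zero]
  rw [← Finset.sum_filter]
  have hM : ∀ p ∈ {p ∈ partials u (k + 1) | k ∉ p.2 ∧ k ∈ p.1.2.2}, p.1.2.2 = {k} := by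
    intro p hp
    rw [Finset.mem_filter, mem_partials] at hp
    refine Finset.eq_singleton_iff_unique_mem.2 ⟨hp.2.2, fun x hx => ?_⟩
    exact Finset.card_le_one.1 hp.1.card_le x hx k hp.2.2
  refine Finset.sum_bij' (fun p _ => ((p.1.1, p.1.2.1, {k}), p.2))
    (fun p _ => ((p.1.1, p.1.2.1, ∅), p.2)) ?_ ?_ ?_ ?_ ?_
  · rintro ⟨⟨A, D, M⟩, O⟩ hp
    simp only [Finset.mem_filter, mem_partials, Finset.card_eq_zero] at hp ⊢
    obtain ⟨hp, rfl⟩ := hp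
    exact ⟨(IsPartial.singleton_diamond_iff hk).2 hp, fun h => (hp.before.opn _ h).ne rfl,
      Finset.mem_singleton_self _⟩
  · intro p hp
    have := hM p hp
    rw [Finset.mem_filter, mem_partials, this] at hp
    rw [Finset.mem_filter, mem_partials]
    exact ⟨(IsPartial.singleton_diamond_iff hk).1 hp.1, Finset.card_empty⟩
  · rintro ⟨⟨A, D, M⟩, O⟩ hp
    simp only [Finset.mem_filter, Finset.card_eq_zero] at hp
    rw [hp.2]
  · intro p hp
    rw [← hM p hp]
  · rintro ⟨⟨A, D, M⟩, O⟩ hp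
    simp only [Finset.mem_filter, mem_partials, Finset.card_eq_zero] at hp
    obtain ⟨hp, rfl⟩ := hp
    rw [weight, stat_singleton_diamond m hp.before, Finset.card_singleton]

lemma sum_partials_succ (m : Bool) (f : ℕ × ℕ → ℤ[X]) :
    ∑ p ∈ partials u (k + 1), weight m f p
      = ∑ p ∈ partials u k, weight m (markedOp (u k) f) p := by
  cases hk : u k with
  | D => exact sum_partials_D m f hk
  | U =>
    have h : ∀ p : OpenDiagram N, weight m (markedOp .U f) p
      = X ^ stat m p.1.1 p.1.2.1 p.1.2.2 p.2
          * (X ^ p.1.2.2.card * f (p.2.card + 1, p.1.2.2.card))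
        + X ^ stat m p.1.1 p.1.2.1 p.1.2.2 p.2
          * (X ^ (p.1.2.2.card + p.2.card - 1) * qNum p.2.card
            * f (p.2.card - 1, p.1.2.2.card))
        + X ^ stat m p.1.1 p.1.2.1 p.1.2.2 p.2
          * (if p.1.2.2.card = 0 then f (p.2.card, 1) else 0) := by
      intro p
      rw [← mul_add, ← mul_add]
      rfl
    simp only [h, Finset.sum_add_distrib]
    rw [← sum_partials_open m f hk, ← sum_partials_dash m f hk, ← sum_partials_diamond m f hk,
      ← Finset.sum_filter_add_sum_filter_not (partials u (k + 1)) (fun p => k ∈ p.2), add_assoc]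
    congr 1
    rw [← Finset.sum_filter_add_sum_filter_not _ (fun p => k ∈ p.1.2.2), add_comm,
      Finset.filter_filter, Finset.filter_filter]

lemma partials_zero : partials u 0 = {((∅, ∅, ∅), ∅)} := by
  ext ⟨⟨A, D, M⟩, O⟩
  rw [mem_partials, Finset.mem_singleton]
  constructor
  · intro h
    have := fun i => coverage_eq_zero.1 ((h.perfect i).trans (if_neg (Nat.not_lt_zero _)))
    simp only [Prod.mk.injEq, Finset.eq_empty_iff_forall_notMem]
    exact ⟨⟨fun a ha => ((this a.1).1 a ha).1 rfl, fun a ha => ((this a.1).2.1 a ha).1 rfl,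
      fun a ha => (this a).2.2.1 ha⟩, fun a ha => (this a).2.2.2 ha⟩
  · rintro h
    simp only [Prod.mk.injEq] at h
    obtain ⟨⟨rfl, rfl, rfl⟩, rfl⟩ := h
    exact ⟨by simp, by simp, by simp, by simp, by simp, by simp [coverage]⟩

/-- The sum does not depend on `k`: each letter passes from the word still to be read into the
partial matchings. The value is read off at `k = 0`. -/
lemma sum_partials (m : Bool) (u : Path N) (k : ℕ) (hk : k ≤ N) :
    ∑ p ∈ partials u k, weight m (evalWord markedOp markedFin ((List.ofFn u).drop k)) p
      = evalWord markedOp markedFin (List.ofFn u) (0, 0) := by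
  induction k with
  | zero => simp [partials_zero, weight, stat]
  | succ k ih =>
    rw [← ih (by omega), List.drop_eq_getElem_cons (i := k) (by simpa using hk)]
    have := sum_partials_succ (u := u) (k := ⟨k, hk⟩) m
      (evalWord markedOp markedFin ((List.ofFn u).drop (k + 1)))
    rw [List.getElem_ofFn]
    exact this

lemma isMatchingI_iff {π : Diagram N} :
    π.IsMatchingI u ↔ IsPartial u N π.arcs π.dashed π.diamonds ∅ := by
  have h : ∀ i, coverage π.arcs π.dashed π.diamonds ∅ i
      = ({a ∈ π.arcs | a.1 = i ∨ a.2 = i}).card + ({a ∈ π.dashed | a.1 = i ∨ a.2 = i}).card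
      + ({j ∈ π.diamonds | j = i}).card := by
    intro i
    simp [coverage]
  constructor
  · intro H
    exact ⟨H.arc, H.dash, H.diamond, by simp, H.diamond_le_one,
      fun i => by rw [h, H.perfect, if_pos i.2]⟩
  · intro H
    exact ⟨H.arc, H.dash, H.diamond, H.card_le,
      fun i => by rw [← h, H.perfect, if_pos i.2]⟩

/-- Arcs and dashed arcs cover two positions each, so for odd `N` the number of diamonds is odd. -/
lemma IsPartial.card_diamond (hN : Odd N) {A D : Finset (Fin N × Fin N)} {M : Finset (Fin N)}
    (h : IsPartial u N A D M ∅) : M.card = 1 := by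
  have h1 : ∑ i, coverage A D M ∅ i = N := by
    simp [h.perfect]
  have h2 : ∀ B : Finset (Fin N × Fin N), (∀ a ∈ B, a.1 < a.2) →
      ∑ i, ({a ∈ B | a.1 = i ∨ a.2 = i}).card = 2 * B.card := by
    intro B hB
    simp only [Finset.card_filter]
    rw [Finset.sum_comm, Finset.card_eq_sum_ones, Finset.mul_sum]
    refine Finset.sum_congr rfl fun a ha => ?_
    have : ∀ i, (if a.1 = i ∨ a.2 = i then 1 else 0)
        = (if a.1 = i then 1 else 0) + if a.2 = i then 1 else 0 := by
      intro i
      have := (hB a ha).ne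
      grind
    simp [this, Finset.sum_add_distrib]
  have h3 : ∑ i, ({j ∈ M | j = i}).card = M.card := by
    simp only [Finset.card_filter]
    rw [Finset.sum_comm]
    simp
  simp only [coverage, Finset.sum_add_distrib, h2 A fun a ha => (h.arc a ha).1,
    h2 D fun a ha => (h.dash a ha).1, h3, Finset.filter_empty, Finset.card_empty,
    Finset.sum_const_zero] at h1
  have := h.card_le
  grind

lemma mem_matchingsI {π : Diagram N} : π ∈ matchingsI u ↔ π.IsMatchingI u := by
  simp [matchingsI]

/-- The generating functions of the generalized perfect matchings of type I. -/
lemma sum_matchingsI (m : Bool) (hN : Odd N) (u : Path N) :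
    ∑ π ∈ matchingsI u, (X : ℤ[X]) ^ (stat m π.arcs π.dashed π.diamonds ∅)
      = openSystem.ev (List.ofFn u) 0 := by
  rw [openSystem_ev, qNum_zero, zero_mul, add_zero, ← sum_partials m u N le_rfl]
  symm
  have h : ∀ p ∈ partials u N, weight m (evalWord markedOp markedFin ((List.ofFn u).drop N)) p
      = if p.2 = ∅ then X ^ stat m p.1.arcs p.1.dashed p.1.diamonds ∅ else 0 := by
    rintro ⟨⟨A, D, M⟩, O⟩ hp
    rw [mem_partials] at hp
    rw [List.drop_eq_nil_of_le (by simp)]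
    simp only [weight, evalWord, markedFin, Prod.mk.injEq, Finset.card_eq_zero]
    by_cases hO : O = ∅
    · subst hO
      rw [if_pos ⟨rfl, hp.card_diamond hN⟩, mul_one, if_pos rfl]
      rfl
    · rw [if_neg (fun h => hO h.1), if_neg hO, mul_zero]
  rw [Finset.sum_congr rfl h, ← Finset.sum_filter]
  refine Finset.sum_bij' (fun p _ => p.1) (fun π _ => (π, ∅)) ?_ ?_ ?_ ?_ (fun _ _ => rfl)
  · rintro ⟨π, O⟩ hp
    simp only [Finset.mem_filter, mem_partials] at hp
    obtain ⟨hp, rfl⟩ := hp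
    exact mem_matchingsI.2 (isMatchingI_iff.2 hp)
  · intro π hπ
    simp only [Finset.mem_filter, mem_partials, and_true]
    exact isMatchingI_iff.1 (mem_matchingsI.1 hπ)
  · rintro ⟨π, O⟩ hp
    simp only [Finset.mem_filter] at hp
    rw [hp.2]
  · intro π _
    rfl

end Diagram

/-! ### Runs through the states of the tilings -/

/-- The number of boxes that an up step of the upper path adds to a column. -/
def gain : Step → ℕ
  | .U => 1
  | .D => 0

/-- The choices for a step `s` of the upper path in a state: a step of the lower path, and the
number of levels that are continued. -/
def choices (s : Step) (p : State) : Finset (Step × ℕ) :=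
  (Finset.range (p.1.length + gain s)).image (fun i => (.U, size p.2 + i))
    ∪ if p.2 = [] then ∅ else {(.D, size p.2)}

/-- The state after a choice. -/
def nextState (s : Step) : State → Step × ℕ → State
  -- When the lower path goes up, the number of boxes in the column changes by `gain s - 1`, when it
  -- goes down, by `gain s`; the boxes not continued from the left are new.
  | (a, r), (.U, e) => upState a r (e - size r) (size (a :: r) - e + gain s - 1)
  -- A default value: `choices` offers no down step at height `0`.
  | (a, []), (.D, _) => (a, [])
  | (a, b :: r), (.D, e) => downState b r (size (a :: b :: r) - e + gain s)

lemma mem_choices {s : Step} {a : List Bool} {r : List (List Bool)} {c : Step × ℕ} :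
    c ∈ choices s (a, r) ↔ (c.1 = .U ∧ size r ≤ c.2 ∧ c.2 < size r + a.length + gain s)
      ∨ (c.1 = .D ∧ r ≠ [] ∧ c.2 = size r) := by
  obtain ⟨t, e⟩ := c
  simp only [choices, Finset.mem_union, Finset.mem_image, Finset.mem_range, Prod.mk.injEq]
  refine or_congr ?_ ?_
  · constructor
    · rintro ⟨i, hi, rfl, rfl⟩
      exact ⟨rfl, by omega, by omega⟩
    · rintro ⟨rfl, h1, h2⟩
      exact ⟨e - size r, by omega, rfl, by omega⟩
  · split_ifs with h <;> simp [h]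

lemma tileFun_eq (f : State → ℤ[X]) (s : Step) (p : State) :
    tileFun f s p
      = ∑ c ∈ choices s p, X ^ (size (p.1 :: p.2) - c.2) * f (nextState s p c) := by
  obtain ⟨a, r⟩ := p
  have h : tileFun f s (a, r) = ∑ i ∈ Finset.range (a.length + gain s),
      X ^ (a.length - i) * f (upState a r i (a.length - i + gain s - 1))
      + X ^ a.length * downPart f (a.length + gain s) r := by
    cases s <;> rfl
  rw [h, choices, Finset.sum_union, Finset.sum_image]
  · congr 1
    · refine Finset.sum_congr rfl fun i _ => ?_
      simp only [nextState, size_cons, Nat.add_sub_add_left, Nat.add_sub_cancel_left]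
    · rcases r with _ | ⟨b, r⟩
      · simp [downPart]
      · simp [downPart, nextState, size_cons]
  · intro i _ j _ hij
    simpa using hij
  · rw [Finset.disjoint_left]
    intro c hc
    rw [Finset.mem_image] at hc
    obtain ⟨i, -, rfl⟩ := hc
    split_ifs <;> simp

/-- The runs of a word from a state. -/
def runs : List Step → State → Finset (List (Step × ℕ))
  | [], _ => {[]}
  | s :: w, p => (choices s p).biUnion fun c => (runs w (nextState s p c)).image (List.cons c)

/-- The weight of a run. -/
noncomputable def runWeight : List Step → State → List (Step × ℕ) → ℤ[X]
  | [], p, _ => tileFin p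
  | _ :: _, _, [] => 0
  | s :: w, p, c :: ρ => X ^ (size (p.1 :: p.2) - c.2) * runWeight w (nextState s p c) ρ

lemma cons_mem_runs {s : Step} {w : List Step} {p : State} {c : Step × ℕ}
    {ρ : List (Step × ℕ)} :
    c :: ρ ∈ runs (s :: w) p ↔ c ∈ choices s p ∧ ρ ∈ runs w (nextState s p c) := by
  simp only [runs, Finset.mem_biUnion, Finset.mem_image, List.cons.injEq]
  constructor
  · rintro ⟨c, hc, ρ, hρ, rfl, rfl⟩
    exact ⟨hc, hρ⟩
  · rintro ⟨hc, hρ⟩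
    exact ⟨c, hc, ρ, hρ, rfl, rfl⟩

lemma length_of_mem_runs {w : List Step} {p : State} {ρ : List (Step × ℕ)} (h : ρ ∈ runs w p) :
    ρ.length = w.length := by
  induction w generalizing p ρ with
  | nil => simp [runs] at h; simp [h]
  | cons s w ih =>
    simp only [runs, Finset.mem_biUnion, Finset.mem_image] at h
    obtain ⟨c, -, ρ, hρ, rfl⟩ := h
    simp [ih hρ]

lemma tileSystem_ev (w : List Step) (p : State) :
    tileSystem.ev w p = ∑ ρ ∈ runs w p, runWeight w p ρ := by
  induction w generalizing p with
  | nil => simp [runs, runWeight, StepSystem.ev, evalWord, tileSystem]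
  | cons s w ih =>
    have h1 : tileSystem.ev (s :: w) p = tileFun (tileSystem.ev w) s p := rfl
    rw [h1, tileFun_eq, runs, Finset.sum_biUnion]
    · refine Finset.sum_congr rfl fun c _ => ?_
      rw [Finset.sum_image (fun _ _ _ _ h => List.tail_eq_of_cons_eq h), ih, Finset.mul_sum]
      rfl
    · intro c _ c' _ hcc'
      simp only [Function.onFun, Finset.disjoint_left, Finset.mem_image, not_exists, not_and]
      rintro _ ⟨ρ, -, rfl⟩ ρ' - h
      exact hcc' (List.head_eq_of_cons_eq h).symm

lemma length_levels (r : List (List Bool)) : (levels r).length = size r := rfl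

lemma lt_of_mem_levels {r : List (List Bool)} {x : ℕ × Bool} (h : x ∈ levels r) :
    x.1 < r.length := by
  induction r with
  | nil => simp [levels] at h
  | cons a r ih =>
    simp only [levels, List.mem_append, List.mem_map] at h
    rcases h with h | ⟨b, -, rfl⟩
    · have := ih h
      simp only [List.length_cons]
      omega
    · simp

/-- The number of new levels after a choice. -/
def newLevels (s : Step) (n : ℕ) : Step × ℕ → ℕ
  | (.U, e) => n - e + gain s - 1
  | (.D, e) => n - e + gain s

/-- For either step of the lower path, a choice cuts the list of levels at `c.2` and puts a single
new group on top. This uniform form is what is compared with codes. -/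
lemma levels_nextState {s : Step} {p : State} {c : Step × ℕ} (h : c ∈ choices s p) :
    levels ((nextState s p c).1 :: (nextState s p c).2) = (levels (p.1 :: p.2)).take c.2
      ++ (freshGroup (newLevels s (size (p.1 :: p.2)) c)).map
        fun b => ((nextState s p c).2.length, b) := by
  obtain ⟨a, r⟩ := p
  obtain ⟨t, e⟩ := c
  rw [mem_choices] at h
  rcases h with ⟨h1, h2, h3⟩ | ⟨h1, h2, h3⟩ <;> simp only at h1 h2 h3 <;> subst h1
  · simp only [nextState, upState, levels, newLevels, List.take_append, length_levels,
      List.take_of_length_le (show (levels r).length ≤ e from h2), List.map_take]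
  · subst h3
    rcases r with _ | ⟨b, r⟩
    · exact absurd rfl h2
    · simp only [nextState, downState, levels, newLevels, List.map_append,
        List.take_append, length_levels]
      rw [List.take_of_length_le (l := levels r) (by rw [length_levels, size_cons]; omega),
        List.take_of_length_le (by rw [List.length_map, size_cons b]; omega), List.append_assoc,
        List.append_assoc, show size (b :: r) - (levels r ++ b.map fun b => (r.length, b)).length = 0
          from Nat.sub_self _, List.take_zero, List.nil_append]

/-! ### Codes of tilings -/

section Codes

variable {N : ℕ}

lemma height_zero (w : Path N) : height w 0 = 0 := by simp [height]

lemma height_succ (w : Path N) {k : ℕ} (hk : k < N) :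
    height w (k + 1) = height w k + (w ⟨k, hk⟩).rise := by
  unfold height
  have : (Finset.univ.filter fun i : Fin N => i.val < k + 1)
      = insert ⟨k, hk⟩ (Finset.univ.filter fun i : Fin N => i.val < k) := by
    ext i
    simp only [Finset.mem_filter, Finset.mem_univ, true_and, Finset.mem_insert, Fin.ext_iff]
    omega
  rw [this, Finset.sum_insert (by simp), add_comm]

/-- The number of boxes between two paths on the line `x = k`. -/
def gap (u l : Path N) (k : ℕ) : ℕ := ((height u k - height l k) / 2).toNat

/-- The line on which the tile at level `i` on the line `x = k` starts, if the lowest `e j` levels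
are continued from the line `x = j` to the line `x = j + 1`. -/
def start (e : ℕ → ℕ) : ℕ → ℕ → ℕ
  -- There are no boxes on `x = 0`. The fictitious level `0` is always continued and so always
  -- starts at `0`; in a valid code this makes level `1` the beginning of a group.
  | 0, _ => 0
  | k + 1, i => if i ≤ e k then start e k i else k + 1

lemma start_le (e : ℕ → ℕ) (k i : ℕ) : start e k i ≤ k := by
  induction k with
  | zero => rfl
  | succ k ih => rw [start]; split_ifs <;> omega

/-- The list entry that describes the level `i + 1` on the line `x = k`. -/
def levelEntry (l : Path N) (e : ℕ → ℕ) (k i : ℕ) : ℕ × Bool :=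
  ((height l (start e k (i + 1))).toNat, decide (start e k (i + 1) = start e k i))

/-- The state `p` describes the levels on the line `x = k`. -/
structure Describes (u l : Path N) (e : ℕ → ℕ) (k : ℕ) (p : State) : Prop where
  nonneg : ∀ j ≤ k, 0 ≤ height l j
  lower : height l k = p.2.length
  upper : height u k = p.2.length + 2 * size (p.1 :: p.2)
  levels_eq : levels (p.1 :: p.2) = (List.range (size (p.1 :: p.2))).map (levelEntry l e k)

/-- The conditions on a code between the lines `x = k` and `x = k + 1`. -/
structure ValidStep (u l : Path N) (e : ℕ → ℕ) (k : ℕ) : Prop where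
  nonneg : 0 ≤ height l (k + 1)
  below : height l (k + 1) ≤ height u (k + 1)
  le_gap : e k ≤ gap u l k
  le_gap_succ : e k ≤ gap u l (k + 1)
  closed : ∀ i, e k < i → i ≤ gap u l k → height l (start e k i) = height l k
  continued : ∀ i, 1 ≤ i → i ≤ e k → height l (start e k i) ≤ height l (k + 1)

variable {u l : Path N} {e : ℕ → ℕ} {k : ℕ} {p : State}

/-- Continued levels keep their starts and all later ones start at `k + 1`. The lowest of these
begins a group because the level below it started on `x = k` or earlier. -/
lemma map_range_levelEntry (m : ℕ) :
    (List.range (e k + m)).map (levelEntry l e (k + 1))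
      = (List.range (e k)).map (levelEntry l e k)
        ++ (freshGroup m).map fun b => ((height l (k + 1)).toNat, b) := by
  rw [List.range_add, List.map_append]
  congr 1
  · refine List.map_congr_left fun i hi => ?_
    rw [List.mem_range] at hi
    simp only [levelEntry, start, if_pos (show i + 1 ≤ e k from hi), if_pos hi.le]
  · rcases m with _ | m
    · rfl
    · rw [List.range_succ_eq_map, freshGroup]
      simp only [List.map_cons, List.map_map, List.map_replicate]
      congr 1
      · have := start_le e k (e k)
        simp only [levelEntry, start, add_zero, le_refl, if_true,
          if_neg (show ¬ e k + 1 ≤ e k by omega), Prod.mk.injEq, true_and, decide_eq_false_iff_not]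
        omega
      · rw [List.eq_replicate_iff]
        constructor
        · simp
        · intro b hb
          simp only [List.mem_map, List.mem_range] at hb
          obtain ⟨i, -, rfl⟩ := hb
          simp only [Function.comp_def, levelEntry, start,
            if_neg (show ¬ e k + (i + 1) + 1 ≤ e k by omega),
            if_neg (show ¬ e k + (i + 1) ≤ e k by omega), decide_true]

namespace Describes

lemma gap_eq (h : Describes u l e k p) : gap u l k = size (p.1 :: p.2) := by
  have h1 := h.lower
  have h2 := h.upper
  unfold gap
  omega

lemma height_start_lt (h : Describes u l e k p) {i : ℕ} (hi : i < size p.2) :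
    height l (start e k (i + 1)) < height l k := by
  have h1 : (levels p.2)[i]'hi = levelEntry l e k i := by
    have h2 : (levels (p.1 :: p.2))[i]'(by rw [length_levels, size_cons]; omega)
        = (levels p.2)[i]'hi := by
      simp only [levels]
      exact List.getElem_append_left hi
    rw [← h2]
    simp only [h.levels_eq]
    simp
  have h2 := lt_of_mem_levels (List.getElem_mem (l := levels p.2) hi)
  rw [h1, levelEntry] at h2
  have h3 := h.lower
  have h4 := h.nonneg _ (start_le e k (i + 1))
  simp only at h2
  omega

lemma height_start_eq (h : Describes u l e k p) {i : ℕ} (hi : size p.2 ≤ i)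
    (hi' : i < size (p.1 :: p.2)) : height l (start e k (i + 1)) = height l k := by
  have h2 : (levels (p.1 :: p.2))[i]'hi' = (p.2.length, p.1[i - size p.2]'(by
      rw [size_cons] at hi'; omega)) := by
    simp only [levels]
    rw [List.getElem_append_right (by exact hi), List.getElem_map]
    rfl
  have h1 : (levels (p.1 :: p.2))[i]'hi' = levelEntry l e k i := by
    simp only [h.levels_eq]
    simp
  rw [h1, levelEntry, Prod.mk.injEq] at h2
  have h3 := h.lower
  have h4 := h.nonneg _ (start_le e k (i + 1))
  omega

/-- The levels are sorted by starting height, so `closed` says that `e k` does not cut through the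
lower blocks. If the lower path goes down, `continued` gives the opposite bound and forces `e k =
size r`. -/
lemma mem_choices_iff (h : Describes u l e k p) (hk : k < N) :
    (l ⟨k, hk⟩, e k) ∈ choices (u ⟨k, hk⟩) p ↔ ValidStep u l e k := by
  obtain ⟨a, r⟩ := p
  have hl := height_succ l hk
  have hu := height_succ u hk
  have h1 := h.lower
  have h2 := h.upper
  have hs := size_cons a r
  have h3 : gap u l (k + 1) = ((height u (k + 1) - height l (k + 1)) / 2).toNat := rfl
  have h4 := h.gap_eq
  simp only at h1 h2 h4
  rw [mem_choices]
  have hclosed : (∀ i, e k < i → i ≤ gap u l k → height l (start e k i) = height l k)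
      ↔ size r ≤ e k ∨ size (a :: r) ≤ e k := by
    constructor
    · intro H
      by_contra! hc
      have := H (e k + 1) (by omega) (by omega)
      have := h.height_start_lt (i := e k) hc.1
      omega
    · intro H i hi hi'
      obtain ⟨i, rfl⟩ : ∃ j, i = j + 1 := ⟨i - 1, by omega⟩
      exact h.height_start_eq (by simp only; omega) (by simp only; omega)
  have hle : ∀ i, 1 ≤ i → i ≤ size (a :: r) → height l (start e k i) ≤ height l k := by
    intro i hi hi'
    obtain ⟨i, rfl⟩ : ∃ j, i = j + 1 := ⟨i - 1, by omega⟩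
    rcases lt_or_ge i (size r) with h' | h'
    · exact (h.height_start_lt h').le
    · exact (h.height_start_eq h' (by simp only; omega)).le
  have hcontD : e k ≤ size (a :: r) → ((∀ i, 1 ≤ i → i ≤ e k →
      height l (start e k i) ≤ height l k - 1) ↔ e k ≤ size r) := by
    intro he
    constructor
    · intro H
      by_contra! hc
      have h5 := H (size r + 1) (by omega) (by omega)
      have := h.height_start_eq (i := size r) le_rfl (by simp only; omega)
      omega
    · intro H i hi hi'
      obtain ⟨i, rfl⟩ : ∃ j, i = j + 1 := ⟨i - 1, by omega⟩
      have := h.height_start_lt (i := i) (by simp only; omega)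
      omega
  cases hlk : l ⟨k, hk⟩ with
  | U =>
    rw [hlk, Step.rise] at hl
    constructor
    · rintro (⟨-, h5, h6⟩ | ⟨h5, -⟩)
      swap
      · cases h5
      simp only at h5 h6
      refine ⟨by omega, ?_, ?_, ?_, hclosed.2 (Or.inl h5), fun i hi hi' => ?_⟩
      · cases huk : u ⟨k, hk⟩ <;> simp only [huk, gain, Step.rise] at hu h6 <;> omega
      · cases huk : u ⟨k, hk⟩ <;> simp only [huk, gain, Step.rise] at hu h6 <;> omega
      · cases huk : u ⟨k, hk⟩ <;> simp only [huk, gain, Step.rise] at hu h6 <;> omega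
      · have := hle i hi (by
          cases huk : u ⟨k, hk⟩ <;> simp only [huk, gain] at h6 <;> omega)
        omega
    · intro H
      have h5 := H.le_gap
      have h6 := H.le_gap_succ
      have h7 := H.below
      have h8 := hclosed.1 H.closed
      refine Or.inl ⟨rfl, ?_, ?_⟩
      · simp only; omega
      · cases huk : u ⟨k, hk⟩ <;> simp only [huk, gain, Step.rise] at hu ⊢ <;> omega
  | D =>
    rw [hlk, Step.rise] at hl
    constructor
    · rintro (⟨h5, -⟩ | ⟨-, h5, h6⟩)
      · cases h5
      simp only at h6
      have h7 : 0 < r.length := List.length_pos_of_ne_nil h5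
      refine ⟨by omega, ?_, by omega, ?_, hclosed.2 (Or.inl h6.ge), fun i hi hi' => ?_⟩
      · cases huk : u ⟨k, hk⟩ <;> simp only [huk, Step.rise] at hu <;> omega
      · cases huk : u ⟨k, hk⟩ <;> simp only [huk, Step.rise] at hu <;> omega
      · have := (hcontD (by omega)).2 h6.le i hi hi'
        omega
    · intro H
      have h5 := H.le_gap
      have h8 := hclosed.1 H.closed
      have h9 := (hcontD (by omega)).1 (fun i hi hi' => by
        have := H.continued i hi hi'
        omega)
      have h10 := H.nonneg
      refine Or.inr ⟨rfl, ?_, ?_⟩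
      · rintro rfl
        simp only [List.length_nil] at h1
        omega
      · simp only; omega

lemma next (h : Describes u l e k p) (hk : k < N)
    (hc : (l ⟨k, hk⟩, e k) ∈ choices (u ⟨k, hk⟩) p) :
    Describes u l e (k + 1) (nextState (u ⟨k, hk⟩) p (l ⟨k, hk⟩, e k)) := by
  have hv := (h.mem_choices_iff hk).1 hc
  have h0 := levels_nextState hc
  have hsz : size ((nextState (u ⟨k, hk⟩) p (l ⟨k, hk⟩, e k)).1
      :: (nextState (u ⟨k, hk⟩) p (l ⟨k, hk⟩, e k)).2) = e k
        + newLevels (u ⟨k, hk⟩) (size (p.1 :: p.2)) (l ⟨k, hk⟩, e k) := by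
    have := h.gap_eq
    have h5 := hv.le_gap
    rw [← length_levels, h0, List.length_append, List.length_take, List.length_map,
      length_freshGroup, length_levels, Nat.min_eq_left (by simp only; omega)]
  have hlow : height l (k + 1) = (nextState (u ⟨k, hk⟩) p (l ⟨k, hk⟩, e k)).2.length := by
    rw [height_succ l hk, h.lower]
    obtain ⟨a, r⟩ := p
    rw [mem_choices] at hc
    rcases hc with ⟨h1, h2, h3⟩ | ⟨h1, h2, h3⟩ <;> simp only at h1 h2 h3 <;> rw [h1]
    · simp [nextState, upState, Step.rise]
    · rcases r with _ | ⟨b, r⟩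
      · exact absurd rfl h2
      · simp [nextState, downState, Step.rise]
  refine ⟨fun j hj => ?_, hlow, ?_, ?_⟩
  · rcases Nat.lt_succ_iff_lt_or_eq.1 (Nat.lt_succ_of_le hj) with hj | rfl
    · exact h.nonneg j (by omega)
    · exact hv.nonneg
  · rw [hsz, ← hlow, height_succ u hk, height_succ l hk, h.upper, h.lower]
    have h5 := hv.le_gap
    have h6 := hv.le_gap_succ
    have h7 := h.gap_eq
    have h8 : gap u l (k + 1) = ((height u (k + 1) - height l (k + 1)) / 2).toNat := rfl
    have h9 := hv.below
    rw [height_succ u hk, height_succ l hk, h.upper, h.lower] at h8 h9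
    cases huk : u ⟨k, hk⟩ <;> cases hlk : l ⟨k, hk⟩ <;>
      simp only [huk, hlk, Step.rise, newLevels, gain] at h8 h9 ⊢ <;> omega
  · rw [hsz, map_range_levelEntry, h0, h.levels_eq, List.map_take.symm, List.take_range,
      Nat.min_eq_left (by have := h.gap_eq; have := hv.le_gap; simp only; omega), hlow,
      Int.toNat_natCast]

end Describes

lemma describes_zero (u l : Path N) (e : ℕ → ℕ) : Describes u l e 0 ([], []) := by
  refine ⟨fun j hj => ?_, ?_, ?_, ?_⟩
  · rw [Nat.le_zero.1 hj, height_zero]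
  · simp [height_zero]
  · simp [height_zero, size, levels]
  · simp [size, levels]

/-- The list form of a code. -/
def codeList (l : Path N) (e : ℕ → ℕ) : List (Step × ℕ) := List.ofFn fun i => (l i, e i)

lemma drop_codeList_mem_runs (hk : k ≤ N) (h : Describes u l e k p) :
    (codeList l e).drop k ∈ runs ((List.ofFn u).drop k) p
      ↔ ∀ j, k ≤ j → j < N → ValidStep u l e j := by
  obtain ⟨m, hm⟩ : ∃ m, m = N - k := ⟨_, rfl⟩
  induction m generalizing k p with
  | zero =>
    rw [List.drop_eq_nil_of_le (by simp; omega), List.drop_eq_nil_of_le (by simp [codeList]; omega)]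
    simp only [runs, Finset.mem_singleton, true_iff]
    intro j _ _
    omega
  | succ m ih =>
    have hk' : k < N := by omega
    rw [List.drop_eq_getElem_cons (i := k) (by simpa using hk'),
      List.drop_eq_getElem_cons (i := k) (l := codeList l e) (by simpa [codeList] using hk'),
      cons_mem_runs]
    simp only [codeList, List.getElem_ofFn]
    constructor
    · rintro ⟨h1, h2⟩ j hj hj'
      rcases hj.eq_or_lt with rfl | hj
      · exact (h.mem_choices_iff hk').1 h1
      · exact (ih hk' (h.next hk' h1) (by omega)).1 h2 j hj hj'
    · intro H
      have h1 := (h.mem_choices_iff hk').2 (H k le_rfl hk')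
      exact ⟨h1, (ih hk' (h.next hk' h1) (by omega)).2 fun j hj hj' => H j (by omega) hj'⟩

lemma runWeight_drop_codeList (hk : k ≤ N) (h : Describes u l e k p)
    (hv : ∀ j, k ≤ j → j < N → ValidStep u l e j) :
    ∃ q, Describes u l e N q ∧ runWeight ((List.ofFn u).drop k) p ((codeList l e).drop k)
      = X ^ (∑ j ∈ Finset.Ico k N, (gap u l j - e j)) * tileFin q := by
  obtain ⟨m, hm⟩ : ∃ m, m = N - k := ⟨_, rfl⟩
  induction m generalizing k p with
  | zero =>
    obtain rfl : k = N := by omega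
    refine ⟨p, h, ?_⟩
    rw [List.drop_eq_nil_of_le (by simp)]
    simp [runWeight]
  | succ m ih =>
    have hk' : k < N := by omega
    have h1 := (h.mem_choices_iff hk').2 (hv k le_rfl hk')
    obtain ⟨q, hq, hw⟩ := ih hk' (h.next hk' h1) (fun j hj hj' => hv j (by omega) hj') (by omega)
    refine ⟨q, hq, ?_⟩
    rw [List.drop_eq_getElem_cons (i := k) (by simpa using hk'),
      List.drop_eq_getElem_cons (i := k) (l := codeList l e) (by simpa [codeList] using hk'),
      runWeight, Finset.sum_eq_sum_Ico_succ_bot hk', pow_add, mul_assoc, ← hw, h.gap_eq]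
    simp only [codeList, List.getElem_ofFn]

end Codes

/-! ### The tiling of a code -/

section TilingOfCode

variable {N : ℕ}

lemma height_parity (w : Path N) {k : ℕ} (hk : k ≤ N) : Even (height w k + k) := by
  induction k with
  | zero => simp [height_zero]
  | succ k ih =>
    have := ih (by omega)
    rw [height_succ w hk]
    cases w ⟨k, hk⟩ <;> simp only [Step.rise] <;> push_cast <;> grind

lemma height_le (w : Path N) {k : ℕ} (hk : k ≤ N) : height w k ≤ k := by
  induction k with
  | zero => simp [height_zero]
  | succ k ih =>
    have := ih (by omega)
    rw [height_succ w hk]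
    cases w ⟨k, hk⟩ <;> simp only [Step.rise] <;> push_cast <;> omega

/-- The box at level `i` above the path `l` on the line `x = k`. -/
def box (l : Path N) (k i : ℕ) : Box := (k, height l k + 2 * i - 1)

lemma box_inj {l : Path N} {k k' i i' : ℕ} : box l k i = box l k' i' ↔ k = k' ∧ i = i' := by
  simp only [box, Prod.mk.injEq]
  constructor
  · rintro ⟨rfl, h⟩
    exact ⟨rfl, by omega⟩
  · rintro ⟨rfl, rfl⟩
    exact ⟨rfl, rfl⟩

lemma two_mul_gap {u l : Path N} (h : IsBelow l u) {k : ℕ} (hk : k ≤ N) :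
    2 * (gap u l k : ℤ) = height u k - height l k := by
  have h1 := height_parity u hk
  have h2 := height_parity l hk
  have h3 := h k hk
  unfold gap
  grind

lemma mem_skewShape {u l : Path N} (hl : IsBallot l) (h : IsBelow l u) {b : Box} :
    b ∈ skewShape l u ↔ ∃ k i, 1 ≤ k ∧ k ≤ N ∧ 1 ≤ i ∧ i ≤ gap u l k ∧ b = box l k i := by
  obtain ⟨x, y⟩ := b
  simp only [skewShape, Finset.mem_filter, Finset.mem_product, Finset.mem_Icc, box, Prod.mk.injEq]
  constructor
  · rintro ⟨⟨⟨h1, h2⟩, -⟩, h3, h4, h5⟩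
    have h6 := height_parity l h2
    have h7 := two_mul_gap h h2
    refine ⟨x, ((y - height l x + 1) / 2).toNat, h1, h2, ?_⟩
    grind
  · rintro ⟨k, i, h1, h2, h3, h4, rfl, rfl⟩
    have h6 := height_parity l h2
    have h7 := two_mul_gap h h2
    have h8 := height_le u h2
    have h9 := hl x h2
    refine ⟨⟨⟨h1, h2⟩, by omega, by omega⟩, ?_, by omega, by omega⟩
    grind

/-- The boxes at level `i` above the path `l` on the lines from `x` to `k`. -/
def strip (l : Path N) (x k i : ℕ) : Finset Box := (Finset.Icc x k).image fun y => box l y i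

lemma mem_strip {l : Path N} {x k i : ℕ} {b : Box} :
    b ∈ strip l x k i ↔ ∃ y, (x ≤ y ∧ y ≤ k) ∧ box l y i = b := by
  simp [strip]

lemma box_mem_strip {l : Path N} {x k i y j : ℕ} :
    box l y j ∈ strip l x k i ↔ x ≤ y ∧ y ≤ k ∧ j = i := by
  rw [mem_strip]
  constructor
  · rintro ⟨z, hz, h⟩
    obtain ⟨rfl, rfl⟩ := box_inj.1 h
    exact ⟨hz.1, hz.2, rfl⟩
  · rintro ⟨h1, h2, rfl⟩
    exact ⟨y, ⟨h1, h2⟩, rfl⟩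

lemma height_sub (l : Path N) {x m : ℕ} (hm : x + m ≤ N) (w : Path m)
    (hw : ∀ j : Fin m, w j = l ⟨x + j, by omega⟩) {j : ℕ} (hj : j ≤ m) :
    height w j = height l (x + j) - height l x := by
  induction j with
  | zero => simp [height_zero]
  | succ j ih =>
    rw [height_succ w hj, ih (by omega), hw, ← add_assoc, height_succ l (by omega)]
    ring

/-- A strip copies a piece of the lower path, so its length can be read off from its leftmost and
rightmost boxes. -/
lemma isBallotTile_strip {l : Path N} {x k i : ℕ} (hxk : x ≤ k) (hk : k ≤ N)
    (h : ∀ y, x ≤ y → y ≤ k → height l x ≤ height l y) {n n' : ℕ} :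
    IsBallotTile n n' (strip l x k i)
      ↔ x + (2 * n + n') = k ∧ height l k = height l x + n' := by
  constructor
  · rintro ⟨x0, y0, w, ⟨-, hw⟩, hT⟩
    have hmem : ∀ b, b ∈ strip l x k i ↔ ∃ j < 2 * n + n' + 1, (x0 + j, y0 + height w j) = b := by
      intro b
      rw [hT]
      simp
    obtain ⟨y, hy, hy'⟩ := mem_strip.1 ((hmem _).2 ⟨0, by omega, rfl⟩)
    obtain ⟨z, hz, hz'⟩ := mem_strip.1 ((hmem _).2 ⟨2 * n + n', by omega, rfl⟩)
    obtain ⟨j, hj, hj'⟩ := (hmem _).1 (box_mem_strip.2 ⟨le_refl x, hxk, rfl⟩)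
    obtain ⟨j', hjj, hjj'⟩ := (hmem _).1 (box_mem_strip.2 ⟨hxk, le_refl k, rfl⟩)
    simp only [box, Prod.mk.injEq, height_zero, hw] at hy' hz' hj' hjj'
    obtain rfl : y = x := by omega
    obtain rfl : z = k := by omega
    omega
  · rintro ⟨rfl, h2⟩
    have hw := fun j hj => height_sub l hk
      (fun j : Fin (2 * n + n') => l ⟨x + j, by omega⟩) (fun _ => rfl) (j := j) hj
    refine ⟨x, height l x + 2 * i - 1, fun j => l ⟨x + j, by omega⟩, ⟨fun j hj => ?_, ?_⟩, ?_⟩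
    · rw [hw j hj]
      have := h (x + j) (by omega) (by omega)
      omega
    · rw [hw _ le_rfl]
      omega
    · ext b
      rw [mem_strip]
      simp only [Finset.mem_image, Finset.mem_range]
      constructor
      · rintro ⟨y, hy, rfl⟩
        refine ⟨y - x, by omega, ?_⟩
        rw [hw _ (by omega), show x + (y - x) = y by omega, box]
        simp only [Prod.mk.injEq, true_and]
        ring
      · rintro ⟨j, hj, rfl⟩
        refine ⟨x + j, by omega, ?_⟩
        rw [hw _ (by omega), box]
        simp only [Prod.mk.injEq, true_and]
        ring

lemma exists_isBallotTile_strip {l : Path N} {x k i : ℕ} (hxk : x ≤ k) (hk : k ≤ N)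
    (h : ∀ y, x ≤ y → y ≤ k → height l x ≤ height l y) :
    ∃ n n', IsBallotTile n n' (strip l x k i) := by
  have h1 := height_parity l hk
  have h2 := height_parity l (hxk.trans hk)
  have h3 := h k hxk le_rfl
  have h4 : height l k - height l x ≤ k - x := by
    have := height_le (fun j : Fin (k - x) => l ⟨x + j, by omega⟩) (le_refl (k - x))
    rw [height_sub l (by omega) _ (fun _ => rfl) le_rfl, show x + (k - x) = k by omega] at this
    omega
  refine ⟨(k - x - (height l k - height l x).toNat) / 2, (height l k - height l x).toNat,
    (isBallotTile_strip hxk hk h).2 ?_⟩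
  grind

lemma image_down_strip {l : Path N} {x k i : ℕ} :
    (strip l x k (i + 1)).image down = strip l x k i := by
  simp only [strip, Finset.image_image]
  refine Finset.image_congr fun y _ => ?_
  simp only [Function.comp_apply, down, box, Prod.mk.injEq, true_and]
  push_cast
  ring

variable {e : ℕ → ℕ}

/-- The start of a level changes only where the level is not continued, hence not between the start
of a tile and a later line of the same tile. -/
lemma start_eq_of_mem {k i y : ℕ} (h1 : start e k i ≤ y) (h2 : y ≤ k) :
    start e y i = start e k i ∧ (y < k → i ≤ e y) := by
  induction k with
  | zero =>
    obtain rfl : y = 0 := by omega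
    simp
  | succ k ih =>
    rw [start] at h1 ⊢
    split_ifs at h1 ⊢ with h
    · rcases h2.eq_or_lt with rfl | h2
      · exact ⟨by rw [start, if_pos h], fun h => absurd h (lt_irrefl _)⟩
      · obtain ⟨h3, h4⟩ := ih h1 (by omega)
        refine ⟨h3, fun _ => ?_⟩
        rcases (Nat.le_of_lt_succ h2).eq_or_lt with rfl | h2
        · exact h
        · exact h4 h2
    · obtain rfl : y = k + 1 := by omega
      exact ⟨by rw [start, if_neg h], fun h => absurd h (lt_irrefl _)⟩

lemma start_mono (k : ℕ) : Monotone (start e k) := by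
  intro i j hij
  induction k with
  | zero => exact le_rfl
  | succ k ih =>
    have := start_le e k i
    simp only [start]
    split_ifs <;> omega

/-- The code `(l, e)` is valid for the upper path `u`. -/
def IsCode (u l : Path N) (e : ℕ → ℕ) : Prop := ∀ k < N, ValidStep u l e k

/-- The tile at level `i` ends on the line `x = k`. -/
def IsEnd (u l : Path N) (e : ℕ → ℕ) (k i : ℕ) : Prop :=
  k ≤ N ∧ 1 ≤ i ∧ i ≤ gap u l k ∧ (k = N ∨ e k < i)

/-- The tile at level `i` on the line `x = k`, up to this line. -/
def tile (l : Path N) (e : ℕ → ℕ) (k i : ℕ) : Finset Box := strip l (start e k i) k i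

/-- The tiling of a code. -/
def tilingOf (u l : Path N) (e : ℕ → ℕ) : Finset (Finset Box) :=
  (Finset.range (N + 1)).biUnion fun k =>
    ({i ∈ Finset.Icc 1 (gap u l k) | k = N ∨ e k < i}).image (tile l e k)

variable {u l : Path N}

lemma mem_tilingOf {T : Finset Box} :
    T ∈ tilingOf u l e ↔ ∃ k i, IsEnd u l e k i ∧ tile l e k i = T := by
  simp only [tilingOf, Finset.mem_biUnion, Finset.mem_range, Finset.mem_image, Finset.mem_filter,
    Finset.mem_Icc, IsEnd]
  constructor
  · rintro ⟨k, hk, i, hi, h⟩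
    exact ⟨k, i, ⟨by omega, hi.1.1, hi.1.2, hi.2⟩, h⟩
  · rintro ⟨k, i, hi, h⟩
    exact ⟨k, by omega, i, ⟨⟨hi.2.1, hi.2.2.1⟩, hi.2.2.2⟩, h⟩

lemma gap_zero : gap u l 0 = 0 := by simp [gap, height_zero]

/-- If the two tiles share a line, the one with the smaller end would have to be continued beyond
it. -/
lemma IsEnd.eq {k k' i y : ℕ} (h : IsEnd u l e k i) (h' : IsEnd u l e k' i)
    (hy : start e k i ≤ y) (hyk : y ≤ k) (hy' : start e k' i ≤ y) (hyk' : y ≤ k') : k = k' := by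
  rcases lt_trichotomy k k' with hlt | rfl | hlt
  · have := (start_eq_of_mem (hy'.trans hyk) hlt.le).2 hlt
    obtain ⟨h1, -, -, h2⟩ := h
    obtain ⟨h3, -⟩ := h'
    omega
  · rfl
  · have := (start_eq_of_mem (hy.trans hyk') hlt.le).2 hlt
    obtain ⟨h1, -, -, h2⟩ := h'
    obtain ⟨h3, -⟩ := h
    omega

namespace IsCode

variable (h : IsCode u l e)
include h

lemma isBallot : IsBallot l := by
  intro k hk
  rcases k with _ | k
  · rw [height_zero]
  · exact (h k hk).nonneg

lemma isBelow : IsBelow l u := by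
  intro k hk
  rcases k with _ | k
  · rw [height_zero, height_zero]
  · exact (h k hk).below

lemma start_pos {k i : ℕ} (hk : 1 ≤ k) (hkN : k ≤ N) (hi : 1 ≤ i) : 1 ≤ start e k i := by
  induction k with
  | zero => omega
  | succ k ih =>
    rw [start]
    split_ifs with h'
    · rcases k with _ | k
      · have := (h 0 (by omega)).le_gap
        rw [gap_zero] at this
        omega
      · exact ih (by omega) (by omega)
    · omega

lemma height_start_le {k i : ℕ} (hkN : k ≤ N) (hi : 1 ≤ i) :
    height l (start e k i) ≤ height l k := by
  rcases k with _ | k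
  · exact le_rfl
  · rw [start]
    split_ifs with h'
    · exact (h k hkN).continued i hi h'
    · exact le_rfl

lemma height_start_le_of_mem {k i y : ℕ} (hkN : k ≤ N) (hi : 1 ≤ i) (hy : start e k i ≤ y)
    (hyk : y ≤ k) : height l (start e k i) ≤ height l y := by
  rw [← (start_eq_of_mem hy hyk).1]
  exact h.height_start_le (hyk.trans hkN) hi

lemma le_gap_of_mem {k i y : ℕ} (hkN : k ≤ N) (hi : i ≤ gap u l k) (hy : start e k i ≤ y)
    (hyk : y ≤ k) : i ≤ gap u l y := by
  rcases hyk.eq_or_lt with rfl | hyk'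
  · exact hi
  · exact ((start_eq_of_mem hy hyk).2 hyk').trans (h y (by omega)).le_gap

lemma exists_isEnd {y i : ℕ} (hy : y ≤ N) (hi : 1 ≤ i) (hi' : i ≤ gap u l y) :
    ∃ k, y ≤ k ∧ IsEnd u l e k i ∧ start e k i = start e y i := by
  obtain ⟨m, hm⟩ : ∃ m, m = N - y := ⟨_, rfl⟩
  induction m generalizing y with
  | zero => exact ⟨y, le_rfl, ⟨hy, hi, hi', Or.inl (by omega)⟩, rfl⟩
  | succ m ih =>
    by_cases he : e y < i
    · exact ⟨y, le_rfl, ⟨hy, hi, hi', Or.inr he⟩, rfl⟩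
    · push Not at he
      obtain ⟨k, hk, h1, h2⟩ := ih (y := y + 1) (by omega)
        (he.trans (h y (by omega)).le_gap_succ) (by omega)
      exact ⟨k, by omega, h1, by rw [h2, start, if_pos he]⟩

lemma isBallotTile_tile {k i : ℕ} (hi : IsEnd u l e k i) {n n' : ℕ} :
    IsBallotTile n n' (tile l e k i)
      ↔ start e k i + (2 * n + n') = k ∧ height l k = height l (start e k i) + n' :=
  isBallotTile_strip (start_le e k i) hi.1 fun _ => h.height_start_le_of_mem hi.1 hi.2.1

/-- By `closed`, a tile that stops before `x = N` stops at its starting height and is a Dyck tile.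
-/
lemma eq_of_isBallotTile {k i : ℕ} (hi : IsEnd u l e k i) {n n' : ℕ} (hn : 1 ≤ n')
    (hT : IsBallotTile n n' (tile l e k i)) : k = N := by
  rw [h.isBallotTile_tile hi] at hT
  rcases hi.2.2.2 with h' | h'
  · exact h'
  · by_contra hc
    have := (h k (by have := hi.1; omega)).closed i h' hi.2.2.1
    omega

end IsCode

/-- The condition of type BI on a code. -/
structure IsEvenCode (u l : Path N) (e : ℕ → ℕ) : Prop where
  odd : ∀ i, 1 ≤ i → i ≤ gap u l N →
    height l (start e N i) < height l N → Odd (height l N - height l (start e N i))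
  even : ∀ x, height l x < height l N →
    Even ({i ∈ Finset.Icc 1 (gap u l N) | start e N i = x}).card

lemma tile_injOn (k : ℕ) : Set.InjOn (tile l e k) Set.univ := by
  intro i _ j _ hij
  have : box l k i ∈ tile l e k j := by
    rw [← hij]
    exact box_mem_strip.2 ⟨start_le e k i, le_rfl, rfl⟩
  exact (box_mem_strip.1 this).2.2

open Classical in
lemma IsCode.filter_isBallotTile (h : IsCode u l e) {n n' : ℕ} (hn : 1 ≤ n') :
    ({T ∈ tilingOf u l e | IsBallotTile n n' T}).card
      = ({i ∈ Finset.Icc 1 (gap u l N) | start e N i + (2 * n + n') = N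
          ∧ height l N = height l (start e N i) + n'}).card := by
  rw [← Finset.card_image_of_injOn ((tile_injOn (l := l) (e := e) N).mono (Set.subset_univ _))]
  congr 1
  ext T
  simp only [Finset.mem_filter, mem_tilingOf, Finset.mem_image, Finset.mem_Icc]
  constructor
  · rintro ⟨⟨k, i, hi, rfl⟩, hT⟩
    obtain rfl := h.eq_of_isBallotTile hi hn hT
    exact ⟨i, ⟨⟨hi.2.1, hi.2.2.1⟩, (h.isBallotTile_tile hi).1 hT⟩, rfl⟩
  · rintro ⟨i, ⟨hi, hT⟩, rfl⟩
    have hi : IsEnd u l e N i := ⟨le_rfl, hi.1, hi.2, Or.inl rfl⟩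
    exact ⟨⟨N, i, hi, rfl⟩, (h.isBallotTile_tile hi).2 hT⟩

/-- Since the lowest levels are the continued ones, a tile starts no earlier and stops no later than
the one just below it: this is cover-inclusiveness. The parity conditions concern only the levels on
`x = N`. -/
lemma IsCode.isTilingBI (h : IsCode u l e) (he : IsEvenCode u l e) :
    IsTilingBI l u (tilingOf u l e) := by
  have hmem : ∀ {k i}, IsEnd u l e k i → ∀ b, b ∈ tile l e k i ↔
      ∃ y, (start e k i ≤ y ∧ y ≤ k) ∧ box l y i = b := fun _ _ => mem_strip
  refine ⟨?_, ?_, ?_, ?_, ?_, ?_, ?_⟩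
  · intro T hT
    obtain ⟨k, i, hi, rfl⟩ := mem_tilingOf.1 hT
    exact exists_isBallotTile_strip (start_le e k i) hi.1
      fun _ => h.height_start_le_of_mem hi.1 hi.2.1
  · intro T hT T' hT' hne
    obtain ⟨k, i, hi, rfl⟩ := mem_tilingOf.1 hT
    obtain ⟨k', i', hi', rfl⟩ := mem_tilingOf.1 hT'
    rw [Finset.disjoint_left]
    intro b hb hb'
    obtain ⟨y, hy, rfl⟩ := (hmem hi b).1 hb
    obtain ⟨h1, h2, rfl⟩ := box_mem_strip.1 hb'
    exact hne (by rw [hi.eq hi' hy.1 hy.2 h1 h2])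
  · ext b
    rw [mem_skewShape h.isBallot h.isBelow, Finset.mem_biUnion]
    constructor
    · rintro ⟨T, hT, hb⟩
      obtain ⟨k, i, hi, rfl⟩ := mem_tilingOf.1 hT
      obtain ⟨y, hy, rfl⟩ := (hmem hi b).1 hb
      have hk : 1 ≤ k := by
        by_contra hk
        obtain rfl : k = 0 := by omega
        have := hi.2.2.1
        rw [gap_zero] at this
        have := hi.2.1
        omega
      exact ⟨y, i, (h.start_pos hk hi.1 hi.2.1).trans hy.1, hy.2.trans hi.1, hi.2.1,
        h.le_gap_of_mem hi.1 hi.2.2.1 hy.1 hy.2, rfl⟩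
    · rintro ⟨y, i, h1, h2, h3, h4, rfl⟩
      obtain ⟨k, hk, hi, hs⟩ := h.exists_isEnd h2 h3 h4
      exact ⟨_, mem_tilingOf.2 ⟨k, i, hi, rfl⟩,
        box_mem_strip.2 ⟨hs.trans_le (start_le e y i), hk, rfl⟩⟩
  · intro T hT
    obtain ⟨k, i, hi, rfl⟩ := mem_tilingOf.1 hT
    obtain ⟨i, rfl⟩ : ∃ j, i = j + 1 := ⟨i - 1, by have := hi.2.1; omega⟩
    rcases Nat.eq_zero_or_pos i with rfl | hi0
    · left
      intro b hb
      obtain ⟨y, hy, rfl⟩ := (hmem hi b).1 hb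
      simp only [down, box]
      omega
    · right
      obtain ⟨k', hk', hi', hs⟩ := h.exists_isEnd (i := i) hi.1 hi0
        (by have := hi.2.2.1; omega)
      refine ⟨_, mem_tilingOf.2 ⟨k', i, hi', rfl⟩, ?_⟩
      intro b hb
      rw [tile, image_down_strip] at hb
      obtain ⟨y, hy, rfl⟩ := mem_strip.1 hb
      refine box_mem_strip.2 ⟨?_, hy.2.trans hk', rfl⟩
      rw [hs]
      exact (start_mono k (Nat.le_succ i)).trans hy.1
  · intro T hT n n' hn hb
    obtain ⟨k, i, hi, rfl⟩ := mem_tilingOf.1 hT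
    obtain rfl := h.eq_of_isBallotTile hi hn hb
    exact ⟨_, box_mem_strip.2 ⟨start_le e k i, le_rfl, rfl⟩⟩
  · intro n n' hn
    rw [h.filter_isBallotTile hn.pos]
    -- A tile of length `(2n, n')` that ends on `x = N` starts on `x = N - (2n + n')`, so the tiles
    -- counted are all those with this start, or none.
    by_cases hc : 2 * n + n' ≤ N ∧ height l N = height l (N - (2 * n + n')) + n'
    · convert he.even (N - (2 * n + n')) (by have := hn.pos; omega) using 3
      rename_i i
      constructor
      · rintro ⟨h1, h2⟩
        omega
      · intro h1
        rw [h1]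
        exact ⟨by omega, hc.2⟩
    · rw [Finset.filter_false_of_mem]
      · simp
      · rintro i - ⟨h1, h2⟩
        refine hc ⟨by omega, ?_⟩
        rw [show N - (2 * n + n') = start e N i by omega]
        exact h2
  · intro n n' hn hn'
    rw [h.filter_isBallotTile hn', Finset.card_eq_zero, Finset.filter_false_of_mem]
    rintro i hi ⟨h1, h2⟩
    rw [Finset.mem_Icc] at hi
    have := he.odd i hi.1 hi.2 (by omega)
    rw [h2, add_sub_cancel_left] at this
    grind

end TilingOfCode

/-! ### The code of a tiling -/

section CodeOfTiling

variable {N : ℕ} {u l : Path N}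

namespace IsTilingBI

variable {𝒯 : Finset (Finset Box)} (hl : IsBallot l) (hb : IsBelow l u) (H : IsTilingBI l u 𝒯)
include H

lemma eq_of_mem {T T' : Finset Box} (hT : T ∈ 𝒯) (hT' : T' ∈ 𝒯) {b : Box} (h : b ∈ T)
    (h' : b ∈ T') : T = T' := by
  by_contra hne
  exact Finset.disjoint_left.1 (H.disjoint T hT T' hT' hne) h h'

include hl hb

lemma exists_box {T : Finset Box} (hT : T ∈ 𝒯) {b : Box} (h : b ∈ T) :
    ∃ k i, 1 ≤ k ∧ k ≤ N ∧ 1 ≤ i ∧ i ≤ gap u l k ∧ b = box l k i := by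
  rw [← mem_skewShape hl hb, ← H.cover, Finset.mem_biUnion]
  exact ⟨T, hT, h⟩

lemma exists_tile {k i : ℕ} (h1 : 1 ≤ k) (h2 : k ≤ N) (h3 : 1 ≤ i) (h4 : i ≤ gap u l k) :
    ∃ T ∈ 𝒯, box l k i ∈ T := by
  have := (mem_skewShape hl hb).2 ⟨k, i, h1, h2, h3, h4, rfl⟩
  rw [← H.cover, Finset.mem_biUnion] at this
  exact this

/-- Pushing the tile down keeps both boxes in a common tile until it falls below the lower path. A
tile below the path is so as a whole, so both boxes reach level `0` at the same time. -/
lemma level_eq {x i j : ℕ} {T : Finset Box} (hT : T ∈ 𝒯) (hi : box l x i ∈ T)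
    (hj : box l (x + 1) j ∈ T) : i = j := by
  have hpos : ∀ {T : Finset Box}, T ∈ 𝒯 → ∀ {x i}, box l x i ∈ T → 1 ≤ i := by
    intro T hT x i hi
    obtain ⟨_, _, _, _, h, _, hbox⟩ := H.exists_box hl hb hT hi
    rw [(box_inj.1 hbox).2]
    exact h
  have hdown : ∀ x i, down (box l x (i + 1)) = box l x i := by
    intro x i
    simp only [down, box, Prod.mk.injEq, true_and]
    push_cast
    ring
  induction i generalizing j T with
  | zero => exact absurd (hpos hT hi) (by omega)
  | succ i ih =>
    obtain ⟨j, rfl⟩ : ∃ j', j = j' + 1 := ⟨j - 1, by have := hpos hT hj; omega⟩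
    rcases H.coverInclusive T hT with h | ⟨T', hT', h⟩
    · have h1 := h _ hi
      have h2 := h _ hj
      rw [hdown] at h1 h2
      simp only [box] at h1 h2
      omega
    · have h1 := h (Finset.mem_image_of_mem down hi)
      have h2 := h (Finset.mem_image_of_mem down hj)
      rw [hdown] at h1 h2
      rw [ih hT' h1 h2]

/-- By `level_eq` the centres of a tile stay at one level, so the tile copies the lower path. The
anchor condition excludes `n' ≥ 1` for a tile that stops before `x = N`. -/
lemma exists_strip {T : Finset Box} (hT : T ∈ 𝒯) :
    ∃ x k i, 1 ≤ x ∧ x ≤ k ∧ k ≤ N ∧ 1 ≤ i ∧ T = strip l x k i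
      ∧ (∀ y, x ≤ y → y ≤ k → height l x ≤ height l y) ∧ (k < N → height l k = height l x) := by
  obtain ⟨n, n', hT'⟩ := H.tile T hT
  have hanchor := fun hn' => H.anchor T hT n n' hn' hT'
  obtain ⟨x, y, w, ⟨hw, hw'⟩, hTe⟩ := hT'
  have hmem : ∀ b, b ∈ T ↔ ∃ j < 2 * n + n' + 1, (x + j, y + height w j) = b := by
    intro b
    rw [hTe]
    simp
  obtain ⟨x', i, h1, h2, h3, h4, h5⟩ := H.exists_box hl hb hT ((hmem _).2 ⟨0, by omega, rfl⟩)
  simp only [height_zero, add_zero, box, Prod.mk.injEq] at h5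
  obtain ⟨rfl, rfl⟩ := h5
  have hbox : ∀ j ≤ 2 * n + n', (x + j, height l x + 2 * i - 1 + height w j) = box l (x + j) i := by
    intro j hj
    induction j with
    | zero => simp [height_zero, box]
    | succ j ih =>
      have h6 := ih (by omega)
      obtain ⟨z, i', -, -, -, -, h7⟩ :=
        H.exists_box hl hb hT ((hmem _).2 ⟨j + 1, by omega, rfl⟩)
      obtain rfl : x + (j + 1) = z := by
        simp only [box, Prod.mk.injEq] at h7
        exact h7.1
      have h8 := (hmem _).2 ⟨j, by omega, rfl⟩
      have h9 := (hmem _).2 ⟨j + 1, by omega, rfl⟩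
      rw [h6] at h8
      rw [h7] at h9 ⊢
      rw [H.level_eq hl hb hT h8 h9]
  have hheight : ∀ j ≤ 2 * n + n', height w j = height l (x + j) - height l x := by
    intro j hj
    have := hbox j hj
    simp only [box, Prod.mk.injEq, true_and] at this
    omega
  have hk : x + (2 * n + n') ≤ N := by
    obtain ⟨z, _, _, hz, _, _, h7⟩ := H.exists_box hl hb hT
      ((hmem _).2 ⟨2 * n + n', by omega, hbox _ le_rfl⟩)
    rw [(box_inj.1 h7).1]
    exact hz
  refine ⟨x, x + (2 * n + n'), i, h1, by omega, hk, h3, ?_, ?_, ?_⟩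
  · ext b
    rw [hmem, mem_strip]
    constructor
    · rintro ⟨j, hj, rfl⟩
      exact ⟨x + j, by omega, (hbox j (by omega)).symm⟩
    · rintro ⟨z, hz, rfl⟩
      refine ⟨z - x, by omega, ?_⟩
      rw [hbox _ (by omega), show x + (z - x) = z by omega]
  · intro z hz hz'
    have h6 := hheight (z - x) (by omega)
    have h7 := hw (z - x) (by omega)
    rw [show x + (z - x) = z by omega] at h6
    omega
  · intro hlt
    have hn' : n' = 0 := by
      by_contra hn'
      obtain ⟨z, hz⟩ := hanchor (by omega)
      obtain ⟨j, hj, hj'⟩ := (hmem _).1 hz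
      simp only [Prod.mk.injEq] at hj'
      omega
    have := hheight _ le_rfl
    rw [hw'] at this
    omega

/-- The tile at a box of the shape, as a strip. -/
lemma exists_strip_of_box {k i : ℕ} (h1 : 1 ≤ k) (h2 : k ≤ N) (h3 : 1 ≤ i)
    (h4 : i ≤ gap u l k) :
    ∃ x k', strip l x k' i ∈ 𝒯 ∧ 1 ≤ x ∧ x ≤ k ∧ k ≤ k' ∧ k' ≤ N
      ∧ (∀ y, x ≤ y → y ≤ k' → height l x ≤ height l y)
      ∧ (k' < N → height l k' = height l x) := by
  obtain ⟨T, hT, hbT⟩ := H.exists_tile hl hb h1 h2 h3 h4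
  obtain ⟨x, k', i', h5, -, h6, -, rfl, h7, h8⟩ := H.exists_strip hl hb hT
  obtain ⟨h9, h10, rfl⟩ := box_mem_strip.1 hbT
  exact ⟨x, k', hT, h5, h9, h10, h6, h7, h8⟩

end IsTilingBI

/-- The boxes at level `i` on the lines `x = k` and `x = k + 1` are in the same tile. -/
def Linked (l : Path N) (𝒯 : Finset (Finset Box)) (k i : ℕ) : Prop :=
  ∃ T ∈ 𝒯, box l k i ∈ T ∧ box l (k + 1) i ∈ T

open Classical in
/-- The number of levels that are continued from the line `x = k` to the line `x = k + 1`. -/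
noncomputable def linkNumber (u l : Path N) (𝒯 : Finset (Finset Box)) (k : ℕ) : ℕ :=
  Nat.findGreatest (Linked l 𝒯 k) (gap u l k)

namespace IsTilingBI

variable {𝒯 : Finset (Finset Box)} (hl : IsBallot l) (hb : IsBelow l u) (H : IsTilingBI l u 𝒯)
include hl hb H

/-- The tile containing the pushed-down tile links the level below. Hence the linked levels form an
initial segment, recorded by its largest element `linkNumber`. -/
lemma linked_pred {k i : ℕ} (hi : 1 ≤ i) (h : Linked l 𝒯 k (i + 1)) : Linked l 𝒯 k i := by
  obtain ⟨T, hT, h1, h2⟩ := h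
  obtain ⟨x, k', i', -, hxk, -, -, rfl, -⟩ := H.exists_strip hl hb hT
  obtain ⟨h3, h4, rfl⟩ := box_mem_strip.1 h1
  obtain ⟨h5, h6, -⟩ := box_mem_strip.1 h2
  rcases H.coverInclusive _ hT with h | ⟨T', hT', h⟩
  · have := h _ h1
    simp only [down, box] at this
    push_cast at this
    omega
  · rw [image_down_strip] at h
    exact ⟨T', hT', h (box_mem_strip.2 ⟨h3, h4, rfl⟩), h (box_mem_strip.2 ⟨h5, h6, rfl⟩)⟩

lemma linked_iff {k i : ℕ} (hi : 1 ≤ i) : Linked l 𝒯 k i ↔ i ≤ linkNumber u l 𝒯 k := by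
  classical
  constructor
  · rintro ⟨T, hT, h1, h2⟩
    obtain ⟨k', i', -, -, -, h3, h4⟩ := H.exists_box hl hb hT h1
    obtain ⟨rfl, rfl⟩ := box_inj.1 h4
    unfold linkNumber
    exact Nat.le_findGreatest h3 ⟨T, hT, h1, h2⟩
  · intro h
    have h1 : Linked l 𝒯 k (linkNumber u l 𝒯 k) := by
      have : linkNumber u l 𝒯 k ≠ 0 := by omega
      unfold linkNumber at this ⊢
      exact Nat.findGreatest_of_ne_zero rfl this
    refine Nat.decreasingInduction' (fun j _ hj hj' => ?_) h h1
    exact H.linked_pred hl hb (by omega) hj'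

lemma start_eq {x k i : ℕ} (hT : strip l x k i ∈ 𝒯) (hx : 1 ≤ x) (hi : 1 ≤ i) {y : ℕ}
    (hxy : x ≤ y) (hyk : y ≤ k) : start (linkNumber u l 𝒯) y i = x := by
  induction y, hxy using Nat.le_induction with
  | base =>
    obtain ⟨x, rfl⟩ : ∃ x', x = x' + 1 := ⟨x - 1, by omega⟩
    rw [start, if_neg]
    rw [← H.linked_iff hl hb hi]
    rintro ⟨T, hT', h1, h2⟩
    rw [← H.eq_of_mem hT hT' (box_mem_strip.2 ⟨le_rfl, hyk, rfl⟩) h2, box_mem_strip] at h1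
    omega
  | succ y hxy ih =>
    rw [start, if_pos, ih (by omega)]
    rw [← H.linked_iff hl hb hi]
    exact ⟨_, hT, box_mem_strip.2 ⟨hxy, by omega, rfl⟩, box_mem_strip.2 ⟨by omega, hyk, rfl⟩⟩

lemma end_iff {x k i y : ℕ} (hT : strip l x k i ∈ 𝒯) (hi : 1 ≤ i) (hxy : x ≤ y) (hyk : y ≤ k) :
    linkNumber u l 𝒯 y < i ↔ y = k := by
  rw [← not_le, ← H.linked_iff hl hb hi]
  constructor
  · intro h
    by_contra hne
    exact h ⟨_, hT, box_mem_strip.2 ⟨hxy, by omega, rfl⟩,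
      box_mem_strip.2 ⟨by omega, by omega, rfl⟩⟩
  · rintro rfl ⟨T, hT', h1, h2⟩
    rw [← H.eq_of_mem hT hT' (box_mem_strip.2 ⟨hxy, le_rfl, rfl⟩) h1, box_mem_strip] at h2
    omega

lemma isCode : IsCode u l (linkNumber u l 𝒯) := by
  intro k hk
  have hle : linkNumber u l 𝒯 k ≤ gap u l k := by
    classical
    unfold linkNumber
    exact Nat.findGreatest_le _
  have hbox : ∀ i, 1 ≤ i → i ≤ gap u l k → ∃ x k', strip l x k' i ∈ 𝒯 ∧ 1 ≤ x ∧ x ≤ k ∧ k ≤ k'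
      ∧ k' ≤ N ∧ (∀ y, x ≤ y → y ≤ k' → height l x ≤ height l y)
      ∧ (k' < N → height l k' = height l x) := by
    intro i h1 h2
    refine H.exists_strip_of_box hl hb ?_ hk.le h1 h2
    by_contra h
    obtain rfl : k = 0 := by omega
    rw [gap_zero] at h2
    omega
  refine ⟨hl _ hk, hb _ hk, hle, ?_, ?_, ?_⟩
  · rcases Nat.eq_zero_or_pos (linkNumber u l 𝒯 k) with h | h
    · omega
    · obtain ⟨T, hT, -, h2⟩ := (H.linked_iff hl hb h).2 le_rfl
      obtain ⟨k', i', -, -, -, h3, h4⟩ := H.exists_box hl hb hT h2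
      obtain ⟨rfl, h5⟩ := box_inj.1 h4
      omega
  · intro i hi hi'
    obtain ⟨x, k', hT, h1, h2, h3, h4, h5, h6⟩ := hbox i (by omega) hi'
    rw [H.start_eq hl hb hT h1 (by omega) h2 h3]
    obtain rfl := (H.end_iff hl hb hT (by omega) h2 h3).1 hi
    exact (h6 hk).symm
  · intro i hi hi'
    obtain ⟨x, k', hT, h1, h2, h3, h4, h5, h6⟩ := hbox i hi (by omega)
    rw [H.start_eq hl hb hT h1 (by omega) h2 h3]
    have : k ≠ k' := fun h => absurd ((H.end_iff hl hb hT hi h2 h3).2 h) (by omega)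
    exact h5 _ (by omega) (by omega)

lemma tilingOf_linkNumber : tilingOf u l (linkNumber u l 𝒯) = 𝒯 := by
  ext T
  rw [mem_tilingOf]
  constructor
  · rintro ⟨k, i, ⟨h1, h2, h3, h4⟩, rfl⟩
    have hk : 1 ≤ k := by
      by_contra h
      obtain rfl : k = 0 := by omega
      rw [gap_zero] at h3
      omega
    obtain ⟨x, k', hT, h5, h6, h7, h8, -⟩ := H.exists_strip_of_box hl hb hk h1 h2 h3
    have hkk : k = k' := by
      rcases h4 with h4 | h4
      · omega
      · exact (H.end_iff hl hb hT h2 h6 h7).1 h4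
    subst hkk
    rw [BallotTiling.tile, H.start_eq hl hb hT h5 h2 h6 h7]
    exact hT
  · intro hT
    obtain ⟨x, k, i, h1, h2, h3, h4, rfl, -⟩ := H.exists_strip hl hb hT
    -- The second alternative holds even for `k = N`: no tile has a box beyond that line, so nothing
    -- is linked there.
    refine ⟨k, i, ⟨h3, h4, ?_, Or.inr ((H.end_iff hl hb hT h4 h2 le_rfl).2 rfl)⟩, ?_⟩
    · obtain ⟨k', i', -, -, -, h5, h6⟩ :=
        H.exists_box hl hb hT (box_mem_strip.2 ⟨h2, le_rfl, rfl⟩)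
      obtain ⟨rfl, rfl⟩ := box_inj.1 h6
      exact h5
    · rw [BallotTiling.tile, H.start_eq hl hb hT h1 h4 h2 le_rfl]

end IsTilingBI

variable {e : ℕ → ℕ}

/-- Tiles ending on `x = N` with a common start have a common length `(2n, n')`, and conversely, so
the evenness of the tile counts is the evenness of the groups. -/
lemma IsCode.isEvenCode (h : IsCode u l e) (H : IsTilingBI l u (tilingOf u l e)) :
    IsEvenCode u l e := by
  classical
  have hodd : ∀ i, 1 ≤ i → i ≤ gap u l N → height l (start e N i) < height l N →
      ∃ n n', Odd n' ∧ start e N i + (2 * n + n') = N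
        ∧ height l N = height l (start e N i) + n' := by
    intro i h1 h2 h3
    have hi : IsEnd u l e N i := ⟨le_rfl, h1, h2, Or.inl rfl⟩
    obtain ⟨n, n', hT⟩ := H.tile _ (mem_tilingOf.2 ⟨N, i, hi, rfl⟩)
    have hT' := (h.isBallotTile_tile hi).1 hT
    refine ⟨n, n', ?_, hT'⟩
    rw [← Nat.not_even_iff_odd]
    intro hn
    have := H.zero_of_even n n' hn (by omega)
    rw [Finset.card_eq_zero] at this
    exact Finset.filter_eq_empty_iff.1 this (mem_tilingOf.2 ⟨N, i, hi, rfl⟩) hT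
  refine ⟨fun i h1 h2 h3 => ?_, fun x hx => ?_⟩
  · obtain ⟨n, n', hn, -, h4⟩ := hodd i h1 h2 h3
    rw [h4, add_sub_cancel_left]
    exact_mod_cast hn
  · rcases Finset.eq_empty_or_nonempty {i ∈ Finset.Icc 1 (gap u l N) | start e N i = x}
      with h0 | ⟨i, hi⟩
    · simp [h0]
    · simp only [Finset.mem_filter, Finset.mem_Icc] at hi
      obtain ⟨⟨h1, h2⟩, rfl⟩ := hi
      obtain ⟨n, n', hn, h4, h5⟩ := hodd i h1 h2 hx
      have := H.even_of_odd n n' hn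
      rw [h.filter_isBallotTile hn.pos] at this
      convert this using 3
      rename_i j
      constructor
      · intro h6
        rw [h6]
        exact ⟨h4, h5⟩
      · rintro ⟨h6, -⟩
        omega

lemma IsCode.le_iff (h : IsCode u l e) {k i : ℕ} (hk : k < N) (hi : 1 ≤ i) :
    i ≤ e k ↔ Linked l (tilingOf u l e) k i := by
  constructor
  · intro he
    obtain ⟨k', h1, h2, h3⟩ := h.exists_isEnd (y := k + 1) (by omega) hi
      (he.trans (h k hk).le_gap_succ)
    rw [start, if_pos he] at h3
    have h4 := start_le e k i
    exact ⟨_, mem_tilingOf.2 ⟨k', i, h2, rfl⟩, box_mem_strip.2 ⟨by omega, by omega, rfl⟩,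
      box_mem_strip.2 ⟨by omega, by omega, rfl⟩⟩
  · rintro ⟨T, hT, h1, h2⟩
    obtain ⟨k', i', h3, rfl⟩ := mem_tilingOf.1 hT
    obtain ⟨h4, h5, rfl⟩ := box_mem_strip.1 h1
    obtain ⟨h6, h7, -⟩ := box_mem_strip.1 h2
    exact (start_eq_of_mem h4 h5).2 (by omega)

lemma Path.eq_of_height_eq {l l' : Path N} (h : ∀ k ≤ N, height l k = height l' k) : l = l' := by
  funext i
  have h1 := h i i.2.le
  have h2 := h (i + 1) i.2
  rw [height_succ l i.2, height_succ l' i.2, h1] at h2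
  cases h3 : l i <;> cases h4 : l' i <;> simp_all [Step.rise]

/-- If `l'` were higher somewhere, the lowest box above `l` there would belong to the shape of `l`
but lie below `l'`. Thus the shape determines the lower path, and tilings with different lower paths
are different. -/
lemma height_le_of_skewShape {l' : Path N} (hl : IsBallot l) (hb : IsBelow l u)
    (hl' : IsBallot l') (hb' : IsBelow l' u) (h : skewShape l u = skewShape l' u) {k : ℕ}
    (hk : k ≤ N) : height l' k ≤ height l k := by
  by_contra! hlt
  have h1 := hb' k hk
  have h2 := two_mul_gap hb hk
  have hk0 : 1 ≤ k := by
    by_contra hk0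
    obtain rfl : k = 0 := by omega
    simp [height_zero] at hlt
  have h3 := (mem_skewShape hl hb).2 ⟨k, 1, hk0, hk, le_rfl, by omega, rfl⟩
  rw [h, mem_skewShape hl' hb'] at h3
  obtain ⟨k', i, -, -, h4, -, h5⟩ := h3
  simp only [box, Prod.mk.injEq] at h5
  obtain ⟨rfl, h5⟩ := h5
  omega

lemma IsCode.eq_of_tilingOf_eq {l' : Path N} {e' : ℕ → ℕ} (h : IsCode u l e)
    (h' : IsCode u l' e') (H : IsTilingBI l u (tilingOf u l e))
    (H' : IsTilingBI l' u (tilingOf u l' e')) (heq : tilingOf u l e = tilingOf u l' e') :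
    l = l' ∧ ∀ k < N, e k = e' k := by
  have hs : skewShape l u = skewShape l' u := by
    rw [← H.cover, ← H'.cover, heq]
  obtain rfl : l = l' := Path.eq_of_height_eq fun k hk => le_antisymm
    (height_le_of_skewShape h'.isBallot h'.isBelow h.isBallot h.isBelow hs.symm hk)
    (height_le_of_skewShape h.isBallot h.isBelow h'.isBallot h'.isBelow hs hk)
  refine ⟨rfl, fun k hk => ?_⟩
  have hi : ∀ i, 1 ≤ i → (i ≤ e k ↔ i ≤ e' k) := by
    intro i h1
    rw [h.le_iff hk h1, h'.le_iff hk h1, heq]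
  apply le_antisymm
  · rcases Nat.eq_zero_or_pos (e k) with h0 | h0
    · omega
    · exact (hi _ h0).1 le_rfl
  · rcases Nat.eq_zero_or_pos (e' k) with h0 | h0
    · omega
    · exact (hi _ h0).2 le_rfl

/-- On each line before the last, the `gap - e` levels that are not continued end Dyck tiles; on the
last line every level ends, and the Dyck tiles are those that start at the final height. -/
lemma IsCode.tiles_eq (h : IsCode u l e) :
    tiles (tilingOf u l e) = ∑ k ∈ Finset.range N, (gap u l k - e k)
      + ({i ∈ Finset.Icc 1 (gap u l N) | height l (start e N i) = height l N}).card := by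
  classical
  have hdyck : ∀ {k i}, IsEnd u l e k i → ((∃ n, IsBallotTile n 0 (tile l e k i))
      ↔ height l (start e k i) = height l k) := by
    intro k i hi
    constructor
    · rintro ⟨n, hn⟩
      have := ((h.isBallotTile_tile hi).1 hn).2
      push_cast at this
      omega
    · intro heq
      obtain ⟨n, n', hn⟩ := exists_isBallotTile_strip (i := i) (start_le e k i) hi.1
        fun _ => h.height_start_le_of_mem hi.1 hi.2.1
      have := ((h.isBallotTile_tile hi).1 hn).2
      obtain rfl : n' = 0 := by omega
      exact ⟨n, hn⟩
  have hset : {T ∈ tilingOf u l e | ∃ n, IsBallotTile n 0 T}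
      = (Finset.range (N + 1)).biUnion fun k => ({i ∈ Finset.Icc 1 (gap u l k) |
        (k = N ∨ e k < i) ∧ height l (start e k i) = height l k}).image (tile l e k) := by
    ext T
    simp only [Finset.mem_filter, mem_tilingOf, Finset.mem_biUnion, Finset.mem_range,
      Finset.mem_image, Finset.mem_Icc]
    constructor
    · rintro ⟨⟨k, i, hi, rfl⟩, hT⟩
      have := hi.1
      exact ⟨k, by omega, i, ⟨⟨hi.2.1, hi.2.2.1⟩, hi.2.2.2, (hdyck hi).1 hT⟩, rfl⟩
    · rintro ⟨k, hk, i, ⟨⟨h1, h2⟩, h3, h4⟩, rfl⟩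
      have hi : IsEnd u l e k i := ⟨by omega, h1, h2, h3⟩
      exact ⟨⟨k, i, hi, rfl⟩, (hdyck hi).2 h4⟩
  have htiles : tiles (tilingOf u l e) = ({T ∈ tilingOf u l e | ∃ n, IsBallotTile n 0 T}).card := by
    unfold tiles
    congr
  rw [htiles, hset, Finset.card_biUnion]
  · simp_rw [Finset.card_image_of_injOn ((tile_injOn (l := l) (e := e) _).mono
      (Set.subset_univ _))]
    rw [Finset.sum_range_succ]
    congr 1
    · refine Finset.sum_congr rfl fun k hk => ?_
      rw [Finset.mem_range] at hk
      rw [← Nat.card_Ioc]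
      congr 1
      ext i
      simp only [Finset.mem_filter, Finset.mem_Icc, Finset.mem_Ioc]
      constructor
      · rintro ⟨h1, h2, -⟩
        omega
      · intro h1
        exact ⟨by omega, Or.inr h1.1, (h k hk).closed i h1.1 h1.2⟩
    · simp
  · intro k hk k' hk' hne
    simp only [Function.onFun, Finset.disjoint_left]
    intro T hT hT'
    simp only [Finset.mem_image, Finset.mem_filter, Finset.mem_Icc] at hT hT'
    obtain ⟨i, ⟨_, h1⟩, rfl⟩ := hT
    obtain ⟨i', ⟨_, h2⟩, h3⟩ := hT'
    have h4 : box l k i ∈ tile l e k' i' := by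
      rw [h3]
      exact box_mem_strip.2 ⟨start_le e k i, le_rfl, rfl⟩
    have h5 : box l k' i' ∈ tile l e k i := by
      rw [← h3]
      exact box_mem_strip.2 ⟨start_le e k' i', le_rfl, rfl⟩
    have h6 := (box_mem_strip.1 h4).2.1
    have h7 := (box_mem_strip.1 h5).2.1
    omega

end CodeOfTiling

/-! ### The generating function of the tilings -/

section UpperGF

variable {N : ℕ} {u l : Path N} {e : ℕ → ℕ}

lemma card_filter_Icc (m : ℕ) (P : ℕ → Prop) [DecidablePred P] :
    ({i ∈ Finset.Icc 1 m | P i}).card = ({i ∈ Finset.range m | P (i + 1)}).card := by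
  refine Finset.card_nbij' (· - 1) (· + 1) ?_ ?_ ?_ ?_
  · intro i hi
    simp only [Finset.coe_filter, Finset.mem_Icc, Finset.mem_range, Set.mem_ofPred_eq] at hi ⊢
    rw [Nat.sub_add_cancel hi.1.1]
    exact ⟨by omega, hi.2⟩
  · intro i hi
    simp only [Finset.coe_filter, Finset.mem_Icc, Finset.mem_range, Set.mem_ofPred_eq] at hi ⊢
    exact ⟨by omega, hi.2⟩
  · intro i hi
    simp only [Finset.coe_filter, Finset.mem_Icc, Set.mem_ofPred_eq] at hi
    exact Nat.sub_add_cancel hi.1.1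
  · intro i _
    rfl

/-- By monotonicity equal values are adjacent. If the first two values differ, the first occurs only
once; if they agree, the pair can be removed without changing any parity. -/
lemma evenGroups_iff (m : ℕ) (s : ℕ → ℕ) (hs : Monotone s) :
    evenGroups ((List.range m).map fun i => decide (s (i + 1) = s i)) = true
      ↔ ∀ x, Even ({i ∈ Finset.range m | s (i + 1) = x}).card := by
  have hcard : ∀ m (s : ℕ → ℕ) x, ({i ∈ Finset.range (m + 1) | s (i + 1) = x}).card
      = ({i ∈ Finset.range m | s (i + 1 + 1) = x}).card + if s 1 = x then 1 else 0 := by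
    intro m s x
    rw [Finset.card_filter, Finset.card_filter, Finset.sum_range_succ']
  induction m using Nat.twoStepInduction generalizing s with
  | zero => simp [evenGroups]
  | one =>
    simp only [List.range_one, List.map_cons, List.map_nil, evenGroups, Bool.false_eq_true,
      false_iff, not_forall]
    exact ⟨s 1, by simp [Finset.filter_singleton]⟩
  | more m ih _ =>
    have hs2 : Monotone fun i => s (i + 1 + 1) := fun i j hij => hs (by omega)
    have hlist : (List.range (m + 2)).map (fun i => decide (s (i + 1) = s i))
        = decide (s 1 = s 0) :: decide (s 2 = s 1)
          :: (List.range m).map fun i => decide (s (i + 1 + 1 + 1) = s (i + 1 + 1)) := by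
      rw [List.range_succ_eq_map, List.range_succ_eq_map]
      simp [Function.comp_def]
    rw [hlist, evenGroups, Bool.and_eq_true, decide_eq_true_eq]
    refine (and_congr_right' (ih (fun i => s (i + 1 + 1)) hs2)).trans ?_
    have hc : ∀ x, ({i ∈ Finset.range (m + 2) | s (i + 1) = x}).card
        = ({i ∈ Finset.range m | s (i + 1 + 1 + 1) = x}).card
          + (if s 2 = x then 1 else 0) + if s 1 = x then 1 else 0 := by
      intro x
      rw [hcard, hcard m (fun i => s (i + 1))]
    constructor
    · rintro ⟨h1, h2⟩ x
      rw [hc, h1, add_assoc]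
      refine (h2 x).add ?_
      split_ifs <;> decide
    · intro h
      have h1 : s 2 = s 1 := by
        by_contra hne
        have h12 : s 1 < s 2 := lt_of_le_of_ne (hs (by omega)) (Ne.symm hne)
        have := h (s 1)
        rw [hc, if_neg hne, if_pos rfl, Finset.filter_false_of_mem] at this
        · simp at this
        · intro i _
          have := hs (show 2 ≤ i + 1 + 1 + 1 by omega)
          omega
      refine ⟨h1, fun x => ?_⟩
      have := h x
      rw [hc, h1, add_assoc] at this
      have h3 : Even ((if s 1 = x then 1 else 0) + if s 1 = x then 1 else 0) := ⟨_, rfl⟩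
      exact (Nat.even_add.1 this).2 h3

open Classical in
-- The levels in the lower blocks of the last state are the tiles with `n' ≥ 1`, subject to the
-- parity conditions; the top block consists of the Dyck tiles that end on `x = N`. The lower path
-- ends at an odd height because `N` is odd.
lemma tileFin_eq (hN : Odd N) {q : State} (h : Describes u l e N q) :
    tileFin q = if IsEvenCode u l e then
      X ^ ({i ∈ Finset.Icc 1 (gap u l N) | height l (start e N i) = height l N}).card else 0 := by
  obtain ⟨a, r⟩ := q
  have hgap := h.gap_eq
  have hlow := h.lower
  simp only at hgap hlow
  have hsz := size_cons a r
  have hr : Odd r.length := by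
    have := height_parity l (le_refl N)
    rw [hlow] at this
    grind
  have hlt : ∀ i < gap u l N, (height l (start e N (i + 1)) < height l N ↔ i < size r) := by
    intro i hi
    constructor
    · intro h1
      by_contra hc
      have := h.height_start_eq (i := i) (by simpa using hc) (by simp only; omega)
      omega
    · intro h1
      exact h.height_start_lt h1
  have heq : ∀ i < gap u l N, (height l (start e N (i + 1)) = height l N ↔ size r ≤ i) := by
    intro i hi
    constructor
    · intro h1
      by_contra hc
      have := h.height_start_lt (i := i) (by simpa using hc)
      omega
    · intro h1
      exact h.height_start_eq h1 (by simp only; omega)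
  have hlevels : levels r = (List.range (size r)).map (levelEntry l e N) := by
    have h1 := congrArg (List.take (size r)) h.levels_eq
    simp only [levels] at h1
    rw [List.take_append_of_le_length (by rw [length_levels]),
      List.take_of_length_le (by rw [length_levels]), ← List.map_take, List.take_range,
      Nat.min_eq_left (by omega)] at h1
    exact h1
  have hnonneg : ∀ i, 0 ≤ height l (start e N i) := fun i => h.nonneg _ (start_le e N i)
  have hgood : GoodLevels r.length r ↔ IsEvenCode u l e := by
    have hbits : (levels r).map Prod.snd
        = (List.range (size r)).map fun i => decide (start e N (i + 1) = start e N i) := by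
      rw [hlevels, List.map_map]
      rfl
    unfold GoodLevels
    rw [hbits, evenGroups_iff _ _ (start_mono N)]
    have hfil : ∀ x, height l x < height l N →
        ({i ∈ Finset.Icc 1 (gap u l N) | start e N i = x}).card
          = ({i ∈ Finset.range (size r) | start e N (i + 1) = x}).card := by
      intro x hx
      rw [card_filter_Icc]
      congr 1
      ext i
      simp only [Finset.mem_filter, Finset.mem_range]
      constructor
      · rintro ⟨h1, rfl⟩
        exact ⟨(hlt i h1).1 hx, rfl⟩
      · rintro ⟨h1, h2⟩
        exact ⟨by omega, h2⟩
    constructor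
    · rintro ⟨h1, h2⟩
      refine ⟨fun i hi hi' hh => ?_, fun x hx => ?_⟩
      · obtain ⟨i, rfl⟩ : ∃ j, i = j + 1 := ⟨i - 1, by omega⟩
        have h3 := (hlt i hi').1 hh
        have h4 : levelEntry l e N i ∈ levels r := by
          rw [hlevels]
          exact List.mem_map_of_mem (List.mem_range.2 h3)
        have h5 := h2 _ h4
        have h6 := hnonneg (i + 1)
        simp only [levelEntry] at h5
        rw [hlow]
        grind
      · rw [hfil x hx]
        exact h1 x
    · rintro ⟨h1, h2⟩
      refine ⟨fun x => ?_, fun p hp => ?_⟩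
      · by_cases hx : height l x < height l N
        · rw [← hfil x hx]
          exact h2 x hx
        · rw [Finset.filter_false_of_mem]
          · simp
          · intro i hi hix
            rw [Finset.mem_range] at hi
            rw [← hix] at hx
            exact hx ((hlt i (by omega)).2 hi)
      · rw [hlevels, List.mem_map] at hp
        obtain ⟨i, hi, rfl⟩ := hp
        rw [List.mem_range] at hi
        have h5 := h1 (i + 1) (by omega) (by omega) ((hlt i (by omega)).2 hi)
        have h6 := hnonneg (i + 1)
        simp only [levelEntry]
        rw [hlow] at h5
        grind
  have hcard : ({i ∈ Finset.Icc 1 (gap u l N) | height l (start e N i) = height l N}).card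
      = a.length := by
    rw [card_filter_Icc]
    have : {i ∈ Finset.range (gap u l N) | height l (start e N (i + 1)) = height l N}
        = Finset.Ico (size r) (gap u l N) := by
      ext i
      simp only [Finset.mem_filter, Finset.mem_range, Finset.mem_Ico]
      constructor
      · rintro ⟨h1, h2⟩
        exact ⟨(heq i h1).1 h2, h1⟩
      · rintro ⟨h1, h2⟩
        exact ⟨h2, (heq i h2).2 h1⟩
    rw [this, Nat.card_Ico]
    omega
  rw [hcard, tileFin]
  by_cases hE : IsEvenCode u l e
  · rw [if_pos hE, if_pos ⟨hr, hgood.2 hE⟩]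
  · rw [if_neg hE, if_neg (fun h' => hE (hgood.1 h'.2))]

lemma codeList_mem_runs : codeList l e ∈ runs (List.ofFn u) ([], []) ↔ IsCode u l e := by
  have := drop_codeList_mem_runs (Nat.zero_le N) (describes_zero u l e)
  simp only [List.drop_zero] at this
  rw [this]
  exact ⟨fun h j hj => h j (Nat.zero_le j) hj, fun h j _ hj => h j hj⟩

open Classical in
lemma runWeight_codeList (hN : Odd N) (h : IsCode u l e) :
    runWeight (List.ofFn u) ([], []) (codeList l e)
      = if IsEvenCode u l e then X ^ tiles (tilingOf u l e) else 0 := by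
  obtain ⟨q, hq, hw⟩ := runWeight_drop_codeList (Nat.zero_le N) (describes_zero u l e)
    fun j _ hj => h j hj
  simp only [List.drop_zero] at hw
  rw [hw, tileFin_eq hN hq, h.tiles_eq, pow_add, mul_ite, mul_zero, Finset.range_eq_Ico]

/-- The lower path of a run. -/
def runPath (N : ℕ) (ρ : List (Step × ℕ)) : Path N := fun i => (ρ.getD i (.U, 0)).1

/-- The numbers of continued levels of a run. -/
def runLevels (ρ : List (Step × ℕ)) (k : ℕ) : ℕ := (ρ.getD k (.U, 0)).2

lemma codeList_run {ρ : List (Step × ℕ)} (h : ρ.length = N) :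
    codeList (runPath N ρ) (runLevels ρ) = ρ := by
  apply List.ext_getElem
  · simp [codeList, h]
  · intro i h1 h2
    simp [codeList, runPath, runLevels, h2]

lemma codeList_congr {l' : Path N} {e' : ℕ → ℕ} (hl : l = l') (he : ∀ k < N, e k = e' k) :
    codeList l e = codeList l' e' := by
  subst hl
  unfold codeList
  congr 1
  funext i
  rw [he i i.2]

lemma start_congr {e' : ℕ → ℕ} {k : ℕ} (he : ∀ j < k, e j = e' j) (i : ℕ) :
    start e k i = start e' k i := by
  induction k with
  | zero => rfl
  | succ k ih => rw [start, start, he k (Nat.lt_succ_self k), ih fun j hj => he j (by omega)]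

/-- A code is a function on all of `ℕ`, but on `x = N` every level ends whatever the value of `e N`
is, so only the values below `N` matter. -/
lemma tilingOf_congr {e' : ℕ → ℕ} (he : ∀ k < N, e k = e' k) :
    tilingOf u l e = tilingOf u l e' := by
  ext T
  rw [mem_tilingOf, mem_tilingOf]
  refine exists₂_congr fun k i => ?_
  by_cases hk : k ≤ N
  · refine and_congr ?_ ?_
    · unfold IsEnd
      rcases hk.eq_or_lt with rfl | hk
      · simp
      · rw [he k hk]
    · rw [tile, tile, start_congr fun j hj => he j (by omega)]
  · exact ⟨fun h => absurd h.1.1 hk, fun h => absurd h.1.1 hk⟩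

lemma mem_tilingsUpperBI {𝒯 : Finset (Finset Box)} :
    𝒯 ∈ tilingsUpperBI u ↔ ∃ l, IsBallot l ∧ IsBelow l u ∧ IsTilingBI l u 𝒯 := by
  classical
  simp only [tilingsUpperBI, tilingsBI, Finset.mem_biUnion, Finset.mem_filter, Finset.mem_univ,
    true_and, Finset.mem_powerset]
  constructor
  · rintro ⟨l, ⟨h1, h2⟩, -, h3⟩
    exact ⟨l, h1, h2, h3⟩
  · rintro ⟨l, h1, h2, h3⟩
    refine ⟨l, ⟨h1, h2⟩, fun T hT => ?_, h3⟩
    rw [Finset.mem_powerset, ← h3.cover]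
    exact Finset.subset_biUnion_of_mem id hT

/-- The generating function of the tilings is a weight in their step system. -/
theorem upperGF_eq_ev (hN : Odd N) (u : Path N) :
    upperGF u = tileSystem.ev (List.ofFn u) tileSystem.vac := by
  classical
  have hvac : tileSystem.vac = ([], []) := rfl
  have hrun : ∀ ρ ∈ runs (List.ofFn u) ([], []),
      codeList (runPath N ρ) (runLevels ρ) = ρ ∧ IsCode u (runPath N ρ) (runLevels ρ) := by
    intro ρ hρ
    have h1 : codeList (runPath N ρ) (runLevels ρ) = ρ :=
      codeList_run (by rw [length_of_mem_runs hρ, List.length_ofFn])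
    exact ⟨h1, codeList_mem_runs.1 (h1.symm ▸ hρ)⟩
  have hweight : ∀ ρ ∈ runs (List.ofFn u) ([], []), runWeight (List.ofFn u) ([], []) ρ
      = if IsEvenCode u (runPath N ρ) (runLevels ρ)
        then X ^ tiles (tilingOf u (runPath N ρ) (runLevels ρ)) else 0 := by
    intro ρ hρ
    obtain ⟨h1, h2⟩ := hrun ρ hρ
    rw [← runWeight_codeList hN h2, h1]
  rw [hvac, tileSystem_ev, Finset.sum_congr rfl hweight, ← Finset.sum_filter, upperGF]
  symm
  -- The runs left after discarding weight zero are the even codes. Injectivity recovers `l` from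
  -- the shape and `e` from the links; surjectivity is witnessed by `linkNumber`.
  refine Finset.sum_bij (fun ρ _ => tilingOf u (runPath N ρ) (runLevels ρ)) ?_ ?_ ?_
    (fun _ _ => rfl)
  · intro ρ hρ
    rw [Finset.mem_filter] at hρ
    have h2 := (hrun ρ hρ.1).2
    exact mem_tilingsUpperBI.2 ⟨_, h2.isBallot, h2.isBelow, h2.isTilingBI hρ.2⟩
  · intro ρ hρ ρ' hρ' heq
    rw [Finset.mem_filter] at hρ hρ'
    obtain ⟨h1, h2⟩ := hrun ρ hρ.1
    obtain ⟨h1', h2'⟩ := hrun ρ' hρ'.1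
    obtain ⟨h3, h4⟩ := h2.eq_of_tilingOf_eq h2' (h2.isTilingBI hρ.2) (h2'.isTilingBI hρ'.2) heq
    rw [← h1, ← h1']
    exact codeList_congr h3 h4
  · intro 𝒯 h𝒯
    obtain ⟨l, hl, hb, H⟩ := mem_tilingsUpperBI.1 h𝒯
    have hc := H.isCode hl hb
    have ht := H.tilingOf_linkNumber hl hb
    have hmem := codeList_mem_runs.2 hc
    have h1 := hrun _ hmem
    set ρ := codeList l (linkNumber u l 𝒯) with hρ
    have hpath : runPath N ρ = l := by
      funext i
      simp [runPath, hρ, codeList]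
    have hlev : ∀ k < N, runLevels ρ k = linkNumber u l 𝒯 k := by
      intro k hk
      simp [runLevels, hρ, codeList, hk]
    have htil : tilingOf u (runPath N ρ) (runLevels ρ) = 𝒯 := by
      rw [hpath, tilingOf_congr hlev, ht]
    refine ⟨ρ, Finset.mem_filter.2 ⟨hmem, h1.2.isEvenCode ?_⟩, htil⟩
    rw [htil, hpath]
    exact H

end UpperGF

end BallotTiling

theorem mainTheorem6 (N : ℕ) (hN : Odd N) (μ : BallotTiling.Path N)
    (hμ : BallotTiling.IsBallot μ) :
    BallotTiling.upperGF μ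
        = ∑ π ∈ BallotTiling.matchingsI μ, (Polynomial.X : Polynomial ℤ) ^ π.nes ∧
      BallotTiling.upperGF μ
        = ∑ π ∈ BallotTiling.matchingsI μ, (Polynomial.X : Polynomial ℤ) ^ π.cr := by
  have h : BallotTiling.upperGF μ = BallotTiling.openSystem.ev (List.ofFn μ) 0 :=
    (BallotTiling.upperGF_eq_ev hN μ).trans
      (BallotTiling.tileSystem.ev_vac_eq BallotTiling.openSystem N _ (by simp) hN)
  constructor
  · simp_rw [h, BallotTiling.Diagram.nes_eq_stat]
    exact (BallotTiling.Diagram.sum_matchingsI true hN μ).symm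
  · simp_rw [h, BallotTiling.Diagram.cr_eq_stat]
    exact (BallotTiling.Diagram.sum_matchingsI false hN μ).symm
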